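/- Let $n\ge 0$, let $E_{ij}$ be the matrix units of $\mathrm{Mat}_n(\mathbb R)$, $\theta(x)=1,\tfrac12,0$ for $x>0$, $x=0$, $x<0$, and let $r=\sum_{i,j}\theta(j-i)\,E_{ij}\otimes E_{ji}$, with transpose $r^{\mathrm T}=\sum_{i,j}\theta(j-i)E_{ji}\otimes E_{ij}$ and partial transpose $r^{t_2}=\sum_{i,j}\theta(j-i)E_{ij}\otimes E_{ij}$. Write $X_1=X\otimes 1$, $X_2=1\otimes X$, and $\{X_1\otimes Y_2\}$ for the matrix of all brackets, $\sum\{x_{ij},y_{kl}\}E_{ij}\otimes E_{kl}$. The trigonometric Poisson–Lie bracket on functions of a real $n\times n$ matrix $B$ is the biderivation with $\{B_1\otimes B_2\}=-rB_1B_2+B_1B_2r$. The reflection bracket on functions of a matrix $\mathbb A$ is the biderivation with $\{\mathbb A_1\otimes\mathbb A_2\}_{\rm refl}=r\mathbb A_1\mathbb A_2-\mathbb A_1\mathbb A_2r-\mathbb A_1r^{t_2}\mathbb A_2+\mathbb A_2r^{t_2}\mathbb A_1$. Let $\mathcal A_n$ be the set of unipotent upper-triangular matrices. A matrix $B$ is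 in general position if for all $0\le k\le n$ its minor on the last $k$ rows and first $k$ columns, and its minor on the first $k$ rows and last $k$ columns, are nonzero (so $\det B\ne0$). **Transport matrices.** (a) If $T_1$, $T_2$ each carry the trigonometric bracket and the entries of $T_1$ commute with those of $T_2$, then $B=T_2T_1$ carries the trigonometric bracket. (b) Let $S=\sum_{i=1}^n(-1)^iE_{i,n+1-i}$, let $T_1,\widetilde T_1,\overline T_1$ be upper-triangular with $\widetilde T_1S\overline T_1ST_1S=1$ and $T_2,\widetilde T_2,\overline T_2$ lower-triangular with $\widetilde T_2S\overline T_2ST_2S=1$. Then $B=T_2T_1$ is in general position, and $\mathbb A=T_1^{-1}S\widetilde T_2\widetilde T_1^{\mathrm T}S$ is the unique upper-triangular matrix with its diagonal such that $\widetilde{\mathbb A}=B\mathbb AB^{\mathrm T}$ is upper-triangular; moreover $\widetilde{\mathbb A}=S\overline T_2^{-1}(\overline T_1^{\mathrm T})^{-1}ST_2^{\mathrm T}$. **Reflection bracket.** It restricts to upper-triangular matrices with a fixed diagonal, in particular to $\mathcal A_n$: $\{a_{ij},a_{kl}\}_{\rm refl}=0$ at every upper-triangular $\mathbb A$ whenever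 $j\le i$. **Relations.** Let $c\in\mathbb R^n$ (the case $c=(1,\dots,1)$ is the unipotent one). For every $B$ in general position there is exactly one upper-triangular matrix $\mathbb A=\mathbb A(B)$ with diagonal $c$ such that $\widetilde{\mathbb A}=B\mathbb AB^{\mathrm T}$ is upper-triangular, and $\mathbb A$ is a differentiable function of $B$. For $c=(1,\dots,1)$, a matrix $A$ satisfies $A\in\mathcal A_n$ and $BAB^{\mathrm T}\in\mathcal A_n$ if and only if $A=\mathbb A(B)$ and all diagonal entries of $\widetilde{\mathbb A}$ equal $1$. The functions $\det B$ and $\widetilde{\mathbb A}_{kk}$ $(1\le k\le n)$ are Casimirs of the trigonometric bracket, so that all brackets below restrict to $SL_n$ and to the set $\mathcal B_n$ of those $B\in SL_n$ in general position for which $\mathbb A,\widetilde{\mathbb A}\in\mathcal A_n$. With respect to the trigonometric bracket on $B$, at every $B$ in general position, $$\{B_1\otimes B_2\}=-rB_1B_2+B_1B_2r,$$ $$\{B_1\otimes\mathbb A_2\}=B_1r^{\mathrm T}\mathbb A_2-B_1\mathbb A_2r^{t_2},\qquad \{B_1\otimes\widetilde{\mathbb A}_2\}=r^{\mathrm T}B_1\widetilde{\mathbb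 A}_2-\widetilde{\mathbb A}_2r^{t_2}B_1,$$ $$\{\mathbb A_1\otimes\mathbb A_2\}=r\mathbb A_1\mathbb A_2-\mathbb A_1\mathbb A_2r-\mathbb A_1r^{t_2}\mathbb A_2+\mathbb A_2r^{t_2}\mathbb A_1,$$ $$\{\widetilde{\mathbb A}_1\otimes\widetilde{\mathbb A}_2\}=-r\widetilde{\mathbb A}_1\widetilde{\mathbb A}_2+\widetilde{\mathbb A}_1\widetilde{\mathbb A}_2r+\widetilde{\mathbb A}_1r^{t_2}\widetilde{\mathbb A}_2-\widetilde{\mathbb A}_2r^{t_2}\widetilde{\mathbb A}_1,\qquad \{\mathbb A_1\otimes\widetilde{\mathbb A}_2\}=0.$$ Hence, for functions $f,g$ of a matrix that are differentiable at the relevant points, $\{f(\mathbb A),g(\mathbb A)\}=\{f,g\}_{\rm refl}(\mathbb A)$, $\{f(\widetilde{\mathbb A}),g(\widetilde{\mathbb A})\}=-\{f,g\}_{\rm refl}(\widetilde{\mathbb A})$ and $\{f(\mathbb A),g(\widetilde{\mathbb A})\}=0$: the map $B\mapsto\mathbb A$ is Poisson, $B\mapsto\widetilde{\mathbb A}$ is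 anti-Poisson, and in this sense $\mathbb A\mapsto\widetilde{\mathbb A}$ is anti-Poisson. -/

import Mathlib

open Matrix
open scoped Kronecker

namespace PoissonLie

/-- Real `n × n` matrices. -/
abbrev Mat (n : ℕ) : Type := Matrix (Fin n) (Fin n) ℝ

/-- Matrices acting on `ℝⁿ ⊗ ℝⁿ`. -/
abbrev Mat₂ (n : ℕ) : Type := Matrix (Fin n × Fin n) (Fin n × Fin n) ℝ

/-! ### The trigonometric r-matrix -/

/-- `θ(j - i)`, where `θ(x)` is `1`, `1/2`, `0` for `x > 0`, `x = 0`, `x < 0`. -/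
noncomputable def theta {n : ℕ} (i j : Fin n) : ℝ :=
  if i < j then 1 else if i = j then 1 / 2 else 0

/-- The trigonometric r-matrix `r = ∑ θ(j - i) E_{ij} ⊗ E_{ji}`. -/
noncomputable def rMatrix (n : ℕ) : Mat₂ n :=
  ∑ i : Fin n, ∑ j : Fin n,
    theta i j • ((Matrix.single i j 1 : Mat n) ⊗ₖ (Matrix.single j i 1 : Mat n))

/-- Transposition in the second tensor factor only. -/
def partialTranspose₂ {n : ℕ} (M : Mat₂ n) : Mat₂ n :=
  Matrix.of fun p q => M (p.1, q.2) (q.1, p.2)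

/-- `X` acting in the first tensor factor, `X ⊗ 1`. -/
def leg₁ {n : ℕ} (X : Mat n) : Mat₂ n := X ⊗ₖ (1 : Mat n)

/-- `X` acting in the second tensor factor, `1 ⊗ X`. -/
def leg₂ {n : ℕ} (X : Mat n) : Mat₂ n := (1 : Mat n) ⊗ₖ X

/-! ### Brackets of functions of a matrix -/

/-- The partial derivative of `f` along the matrix entry `(i, j)`, at `X`. -/
noncomputable def entryDeriv {n : ℕ} (f : Mat n → ℝ) (X : Mat n) (i j : Fin n) : ℝ :=
  lineDeriv ℝ f X (Matrix.single i j 1)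

/-- The bracket of functions of a matrix whose value on the coordinate functions
`x_{ij}`, `x_{kl}` is the entry of `tensor X` in row `(i, k)` and column `(j, l)`. -/
noncomputable def bracketOf {n : ℕ} (tensor : Mat n → Mat₂ n) (f g : Mat n → ℝ) (X : Mat n) : ℝ :=
  ∑ i, ∑ j, ∑ k, ∑ l, tensor X (i, k) (j, l) * entryDeriv f X i j * entryDeriv g X k l

/-- `-r X₁ X₂ + X₁ X₂ r`. -/
noncomputable def trigTensor {n : ℕ} (X : Mat n) : Mat₂ n :=
  -(rMatrix n * leg₁ X * leg₂ X) + leg₁ X * leg₂ X * rMatrix n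

/-- The trigonometric Poisson–Lie bracket. -/
noncomputable def trigBracket {n : ℕ} : (Mat n → ℝ) → (Mat n → ℝ) → Mat n → ℝ :=
  bracketOf trigTensor

/-- `r A₁ A₂ - A₁ A₂ r - A₁ r^{t₂} A₂ + A₂ r^{t₂} A₁`, the right-hand side of the semiclassical
reflection equation. -/
noncomputable def reflectionTensor {n : ℕ} (A : Mat n) : Mat₂ n :=
  rMatrix n * leg₁ A * leg₂ A - leg₁ A * leg₂ A * rMatrix n
    - leg₁ A * partialTranspose₂ (rMatrix n) * leg₂ A
    + leg₂ A * partialTranspose₂ (rMatrix n) * leg₁ A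

/-- The semiclassical reflection-equation bracket. -/
noncomputable def reflectionBracket {n : ℕ} : (Mat n → ℝ) → (Mat n → ℝ) → Mat n → ℝ :=
  bracketOf reflectionTensor

/-- The bracket on pairs `(T₁, T₂)` for which `T₁` and `T₂` both carry the trigonometric
Poisson–Lie bracket and the entries of `T₁` commute with those of `T₂`. -/
noncomputable def pairBracket {n : ℕ} (f g : Mat n × Mat n → ℝ) (T : Mat n × Mat n) : ℝ :=
  trigBracket (fun X => f (X, T.2)) (fun X => g (X, T.2)) T.1
    + trigBracket (fun X => f (T.1, X)) (fun X => g (T.1, X)) T.2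

/-- `{F ⊗ G}`, for the bracket `br` and matrix-valued functions `F` and `G`: the entry in row
`(i, k)` and column `(j, l)` is `{F_{ij}, G_{kl}}`. -/
def tensorBracket {n : ℕ} {M : Type*} (br : (M → ℝ) → (M → ℝ) → M → ℝ) (F G : M → Mat n) (x : M) :
    Mat₂ n :=
  Matrix.of fun p q => br (fun y => F y p.1 q.1) (fun y => G y p.2 q.2) x

/-! ### The groupoid of upper-triangular forms -/

/-- Upper-triangular matrices. -/
def IsUpper {n : ℕ} (A : Mat n) : Prop := ∀ i j, j < i → A i j = 0

/-- Lower-triangular matrices. -/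
def IsLower {n : ℕ} (A : Mat n) : Prop := ∀ i j, i < j → A i j = 0

/-- Unipotent upper-triangular matrices, the set `𝒜ₙ`. -/
def unipotentUpper (n : ℕ) : Set (Mat n) := {A | IsUpper A ∧ ∀ i, A i i = 1}

/-- The groupoid of pairs `(B, A)` with `B` invertible and `A` and `B A Bᵀ` both unipotent
upper-triangular. -/
def groupoidPairs (n : ℕ) : Set (Mat n × Mat n) :=
  {P | P.1.det ≠ 0 ∧ P.2 ∈ unipotentUpper n ∧ P.1 * P.2 * P.1ᵀ ∈ unipotentUpper n}

/-- `A` is upper-triangular with diagonal `c`, and `B A Bᵀ` is upper-triangular. -/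
def IsCompatible {n : ℕ} (c : Fin n → ℝ) (B A : Mat n) : Prop :=
  IsUpper A ∧ (∀ i, A i i = c i) ∧ IsUpper (B * A * Bᵀ)

/-- The minor of `B` on the last `k` rows and the first `k` columns. -/
noncomputable def lowerLeftMinor {n : ℕ} (B : Mat n) (k : ℕ) (hk : k ≤ n) : ℝ :=
  (B.submatrix (fun i : Fin k => (⟨n - k + i, by omega⟩ : Fin n)) (Fin.castLE hk)).det

/-- The minor of `B` on the first `k` rows and the last `k` columns. -/
noncomputable def upperRightMinor {n : ℕ} (B : Mat n) (k : ℕ) (hk : k ≤ n) : ℝ :=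
  (B.submatrix (Fin.castLE hk) (fun j : Fin k => (⟨n - k + j, by omega⟩ : Fin n))).det

/-- All lower-left and upper-right corner minors of `B`, among them `det B`, are nonzero. -/
def InGeneralPosition {n : ℕ} (B : Mat n) : Prop :=
  ∀ (k : ℕ) (hk : k ≤ n), lowerLeftMinor B k hk ≠ 0 ∧ upperRightMinor B k hk ≠ 0

open Classical in
/-- The matrix `A` with `IsCompatible c B A`. It exists and is unique for `B` in general position;
it is `0` by convention if there is none. -/
noncomputable def sourceForm {n : ℕ} (c : Fin n → ℝ) (B : Mat n) : Mat n :=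
  if h : ∃ A, IsCompatible c B A then h.choose else 0

/-- `B A Bᵀ` for `A = sourceForm c B`. -/
noncomputable def targetForm {n : ℕ} (c : Fin n → ℝ) (B : Mat n) : Mat n :=
  B * sourceForm c B * Bᵀ

/-! ### Transport matrices of the two triangles -/

/-- `S = ∑ (-1)^i E_{i, n+1-i}`, where `i` runs from `1` to `n`. -/
def antidiagS (n : ℕ) : Mat n :=
  Matrix.of fun i j => if j = Fin.rev i then (-1) ^ ((i : ℕ) + 1) else 0

/-- The groupoid path condition `T' S T'' S T S = 1` for the three transport matrices of a
triangle. -/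
def PathCondition {n : ℕ} (T T' T'' : Mat n) : Prop :=
  T' * antidiagS n * T'' * antidiagS n * T * antidiagS n = 1

/-- Transport matrices of the right triangle: upper-triangular, with the path condition. -/
def IsRightTriangle {n : ℕ} (T T' T'' : Mat n) : Prop :=
  IsUpper T ∧ IsUpper T' ∧ IsUpper T'' ∧ PathCondition T T' T''

/-- Transport matrices of the left triangle: lower-triangular, with the path condition. -/
def IsLeftTriangle {n : ℕ} (T T' T'' : Mat n) : Prop :=
  IsLower T ∧ IsLower T' ∧ IsLower T'' ∧ PathCondition T T' T''

end PoissonLie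

open PoissonLie

/-!
The compatible form `A` of `B` solves a linear system: `A` is prescribed on and below the diagonal,
and `B A Bᵀ` is prescribed to vanish below the diagonal. For `B` in general position this system is
nonsingular (`InGeneralPosition.eq_zero`): the corner minors provide vectors `u`, supported on the
last rows, and `v`, supported on the remaining first ones, for which `uᵀ (B A Bᵀ) v = 0` reads off
a single entry of `A`. Cramer's rule then makes `A` a differentiable function of `B`, and its
derivative in a direction `W` is the only strictly upper-triangular `H` for which
`W A Bᵀ + B H Bᵀ + B A Wᵀ` is upper-triangular (`InGeneralPosition.lineDeriv_sourceForm`).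

Every bracket is therefore found by exhibiting such an `H`. A bracket `{F, g}` is the derivative of
`F` along the Hamiltonian field of `g`. For `W = {b_{ij}, B}` one has `H = entryVariation B A i j`,
which gives the brackets of `B` with `A` and with `Ã = B A Bᵀ`, and the Casimir property of the
diagonal of `Ã`. These brackets say that the Hamiltonian fields of the entries of `A` and of `Ã`
are `B N` and `N B`, with `N` the `formGenerator` of `A` and of `Ã` respectively. Along `B N` the
choice `H = -(N A + A Nᵀ)` leaves `Ã` constant. Along `N B` the choice `H = 0` makes `Ã` vary by
`N Ã + Ã Nᵀ`. Both are admissible because the reflection bracket is tangent to the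
upper-triangular matrices with fixed diagonal (`reflectionTensor_apply_eq_zero`), and
`N A + A Nᵀ` is minus the reflection bracket of `A` (`formGenerator_act`). So `A` and `Ã` commute,
and they carry the reflection bracket with opposite signs. The statements for functions of `A` and
`Ã` follow by the chain rule `bracketOf_comp`.

For the transport matrices, the path conditions factor `T₂ T₁` both as an upper-triangular matrix
times `S` times an upper-triangular one and as a lower-triangular matrix times `S` times a
lower-triangular one. This makes all corner minors nonzero
(`lowerLeftMinor_mul_antidiagS_mul_ne_zero`), and the formula for `B A Bᵀ` is obtained by
cancelling the path conditions.
-/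

namespace PoissonLie

variable {n : ℕ}

/-! ### Entries of the r-matrix and of the bracket tensors -/

theorem theta_add_theta_swap (i j : Fin n) : theta i j + theta j i = 1 := by
  unfold theta
  rcases lt_trichotomy i j with h | h | h
  · simp [h, h.not_gt, h.ne']
  · subst h; norm_num
  · simp [h, h.not_gt, h.ne']

theorem theta_swap (i j : Fin n) : theta j i = 1 - theta i j := by
  linarith [theta_add_theta_swap i j]

theorem theta_of_gt {i j : Fin n} (h : j < i) : theta i j = 0 := by
  simp [theta, h.not_gt, h.ne']

theorem theta_self (i : Fin n) : theta i i = 1 / 2 := by simp [theta]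

theorem rMatrix_apply (i k j l : Fin n) :
    rMatrix n (i, k) (j, l) = if k = j ∧ l = i then theta i j else 0 := by
  simp only [rMatrix, Matrix.sum_apply, Matrix.smul_apply, Matrix.kroneckerMap_apply,
    Matrix.single_apply, smul_eq_mul]
  rw [Finset.sum_eq_single i, Finset.sum_eq_single j]
  · by_cases h : k = j <;> by_cases h' : l = i <;> simp [h, h', Ne.symm]
  · intro b _ hb; simp [hb]
  · simp
  · intro b _ hb; simp [hb]
  · simp

theorem leg₁_mul_apply (X : Mat n) (M : Mat₂ n) (i k j l : Fin n) :
    (leg₁ X * M) (i, k) (j, l) = ∑ a, X i a * M (a, k) (j, l) := by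
  simp [leg₁, Matrix.mul_apply, Fintype.sum_prod_type, Matrix.one_apply]

theorem leg₂_mul_apply (X : Mat n) (M : Mat₂ n) (i k j l : Fin n) :
    (leg₂ X * M) (i, k) (j, l) = ∑ a, X k a * M (i, a) (j, l) := by
  simp [leg₂, Matrix.mul_apply, Fintype.sum_prod_type, Matrix.one_apply]

theorem mul_leg₁_apply (X : Mat n) (M : Mat₂ n) (i k j l : Fin n) :
    (M * leg₁ X) (i, k) (j, l) = ∑ a, M (i, k) (a, l) * X a j := by
  simp [leg₁, Matrix.mul_apply, Fintype.sum_prod_type, Matrix.one_apply]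

theorem mul_leg₂_apply (X : Mat n) (M : Mat₂ n) (i k j l : Fin n) :
    (M * leg₂ X) (i, k) (j, l) = ∑ a, M (i, k) (j, a) * X a l := by
  simp [leg₂, Matrix.mul_apply, Fintype.sum_prod_type, Matrix.one_apply]

theorem rMatrix_mul_apply (M : Mat₂ n) (i k j l : Fin n) :
    (rMatrix n * M) (i, k) (j, l) = theta i k * M (k, i) (j, l) := by
  simp [Matrix.mul_apply, Fintype.sum_prod_type, rMatrix_apply, ite_and]

theorem mul_rMatrix_apply (M : Mat₂ n) (i k j l : Fin n) :
    (M * rMatrix n) (i, k) (j, l) = M (i, k) (l, j) * theta l j := by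
  simp [Matrix.mul_apply, Fintype.sum_prod_type, rMatrix_apply, ite_and]

theorem rMatrix_transpose_mul_apply (M : Mat₂ n) (i k j l : Fin n) :
    ((rMatrix n)ᵀ * M) (i, k) (j, l) = theta k i * M (k, i) (j, l) := by
  simp [Matrix.mul_apply, Fintype.sum_prod_type, rMatrix_apply, ite_and]

theorem partialTranspose₂_rMatrix_apply (i k j l : Fin n) :
    partialTranspose₂ (rMatrix n) (i, k) (j, l) = if l = j ∧ k = i then theta i j else 0 := by
  simp [partialTranspose₂, rMatrix_apply]

theorem leg₁_mul_leg₂_apply (X Y : Mat n) (i k j l : Fin n) :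
    (leg₁ X * leg₂ Y) (i, k) (j, l) = X i j * Y k l := by
  rw [leg₁_mul_apply]
  simp [leg₂, Matrix.one_apply]

theorem trigTensor_apply (X : Mat n) (i k j l : Fin n) :
    trigTensor X (i, k) (j, l) = X i l * X k j * (theta l j - theta i k) := by
  rw [trigTensor, Matrix.add_apply, Matrix.neg_apply, mul_rMatrix_apply, Matrix.mul_assoc,
    rMatrix_mul_apply, leg₁_mul_leg₂_apply, leg₁_mul_leg₂_apply]
  ring

theorem leg₁_mul_partialTranspose₂_mul_leg₂_apply (X Y : Mat n) (i k j l : Fin n) :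
    (leg₁ X * partialTranspose₂ (rMatrix n) * leg₂ Y) (i, k) (j, l)
      = theta k j * X i k * Y j l := by
  simp only [mul_leg₂_apply, leg₁_mul_apply, partialTranspose₂_rMatrix_apply]
  simp [ite_and, mul_comm (theta _ _)]

theorem leg₂_mul_partialTranspose₂_mul_leg₁_apply (X Y : Mat n) (i k j l : Fin n) :
    (leg₂ X * partialTranspose₂ (rMatrix n) * leg₁ Y) (i, k) (j, l)
      = theta i l * X k i * Y l j := by
  simp only [mul_leg₁_apply, leg₂_mul_apply, partialTranspose₂_rMatrix_apply]
  simp [ite_and, mul_comm (theta _ _)]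

theorem leg₁_mul_leg₂_mul_partialTranspose₂_apply (X Y : Mat n) (i k j l : Fin n) :
    (leg₁ X * leg₂ Y * partialTranspose₂ (rMatrix n)) (i, k) (j, l)
      = if l = j then ∑ a, theta a j * X i a * Y k a else 0 := by
  rw [Matrix.mul_assoc, leg₁_mul_apply]
  simp only [leg₂_mul_apply, partialTranspose₂_rMatrix_apply]
  split_ifs with h
  · simp only [h, true_and, mul_ite, mul_zero, Finset.sum_ite_eq', Finset.mem_univ, if_true]
    exact Finset.sum_congr rfl fun _ _ => by ring
  · simp [h]

theorem leg₁_mul_rMatrix_transpose_mul_leg₂_apply (X Y : Mat n) (i k j l : Fin n) :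
    (leg₁ X * (rMatrix n)ᵀ * leg₂ Y) (i, k) (j, l)
      = if k = j then ∑ a, theta j a * X i a * Y a l else 0 := by
  rw [Matrix.mul_assoc, leg₁_mul_apply]
  simp only [mul_leg₂_apply, Matrix.transpose_apply, rMatrix_apply]
  split_ifs with h
  · simp only [h, and_true, ite_mul, zero_mul]
    simp
    exact Finset.sum_congr rfl fun _ _ => by ring
  · simp [h]

theorem reflectionTensor_apply (A : Mat n) (i k j l : Fin n) :
    reflectionTensor A (i, k) (j, l)
      = A i l * A k j * (theta i k - theta l j) - theta k j * A i k * A j l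
        + theta i l * A k i * A l j := by
  rw [reflectionTensor, Matrix.add_apply, Matrix.sub_apply, Matrix.sub_apply, mul_rMatrix_apply,
    Matrix.mul_assoc (rMatrix n), rMatrix_mul_apply, leg₁_mul_leg₂_apply, leg₁_mul_leg₂_apply,
    leg₁_mul_partialTranspose₂_mul_leg₂_apply, leg₂_mul_partialTranspose₂_mul_leg₁_apply]
  ring

/-- The bracket of an entry on or below the diagonal with any other entry vanishes at every
upper-triangular matrix: the product `A i l * A k j` needs `k ≤ j ≤ i ≤ l`, where the two values of
`theta` multiplying it agree unless `k = i` or `l = j`, and in these cases the remaining terms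
compensate. -/
theorem reflectionTensor_apply_eq_zero {A : Mat n} (hA : IsUpper A) {i j : Fin n} (hij : j ≤ i)
    (k l : Fin n) : reflectionTensor A (i, k) (j, l) = 0 := by
  rw [reflectionTensor_apply]
  unfold theta
  have h1 := hA i l
  have h2 := hA k j
  have h3 := hA i k
  have h4 := hA j l
  have h5 := hA k i
  have h6 := hA l j
  grind

/-! ### Differential calculus of functions of a matrix -/

section Calculus

attribute [local instance] Matrix.normedAddCommGroup Matrix.normedSpace

theorem differentiableAt_entry (B : Mat n) (i j : Fin n) :
    DifferentiableAt ℝ (fun X : Mat n => X i j) B := by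
  fun_prop

theorem differentiableAt_of_entries {F : Mat n → Mat n} {B : Mat n}
    (hF : ∀ i j, DifferentiableAt ℝ (fun X => F X i j) B) : DifferentiableAt ℝ F B :=
  differentiableAt_pi.2 fun i => differentiableAt_pi.2 fun j => hF i j

theorem DifferentiableAt.entry {F : Mat n → Mat n} {B : Mat n} (hF : DifferentiableAt ℝ F B)
    (i j : Fin n) : DifferentiableAt ℝ (fun X => F X i j) B :=
  differentiableAt_pi.1 (differentiableAt_pi.1 hF i) j

theorem differentiableAt_comp {f : Mat n → ℝ} {F : Mat n → Mat n} {B : Mat n}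
    (hf : DifferentiableAt ℝ f (F B)) (hF : DifferentiableAt ℝ F B) :
    DifferentiableAt ℝ (fun X => f (F X)) B :=
  DifferentiableAt.comp B hf hF

theorem differentiableAt_det {m : Type*} [Fintype m] [DecidableEq m] {M : Mat n → Matrix m m ℝ}
    {B : Mat n} (hM : ∀ i j, DifferentiableAt ℝ (fun X => M X i j) B) :
    DifferentiableAt ℝ (fun X => (M X).det) B := by
  simp only [Matrix.det_apply]
  fun_prop

theorem differentiableAt_matrix_mul {F G : Mat n → Mat n} {B : Mat n}
    (hF : DifferentiableAt ℝ F B) (hG : DifferentiableAt ℝ G B) :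
    DifferentiableAt ℝ (fun X => F X * G X) B := by
  refine differentiableAt_of_entries fun i j => ?_
  simp only [Matrix.mul_apply]
  exact DifferentiableAt.fun_sum fun a _ => (hF.entry i a).mul (hG.entry a j)

/-- The directional derivative of a differentiable function is linear in the direction. -/
theorem lineDeriv_eq_sum_entryDeriv {f : Mat n → ℝ} {X : Mat n} (hf : DifferentiableAt ℝ f X)
    (W : Mat n) : lineDeriv ℝ f X W = ∑ i, ∑ j, W i j * entryDeriv f X i j := by
  have h : ∀ V, lineDeriv ℝ f X V = fderiv ℝ f X V := fun V => hf.lineDeriv_eq_fderiv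
  simp only [entryDeriv, h]
  conv_lhs => rw [Matrix.matrix_eq_sum_single W]
  rw [map_sum]
  refine Finset.sum_congr rfl fun i _ => ?_
  rw [map_sum]
  refine Finset.sum_congr rfl fun j _ => ?_
  rw [← smul_eq_mul, ← map_smul, Matrix.smul_single, smul_eq_mul, mul_one]

theorem lineDeriv_comp {f : Mat n → ℝ} {F : Mat n → Mat n} {B : Mat n}
    (hf : DifferentiableAt ℝ f (F B)) (hF : DifferentiableAt ℝ F B) (W : Mat n) :
    lineDeriv ℝ (fun X => f (F X)) B W
      = lineDeriv ℝ f (F B) (Matrix.of fun i j => lineDeriv ℝ (fun X => F X i j) B W) := by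
  rw [(differentiableAt_comp hf hF).lineDeriv_eq_fderiv, hf.lineDeriv_eq_fderiv]
  have h1 : fderiv ℝ (fun X => f (F X)) B = (fderiv ℝ f (F B)).comp (fderiv ℝ F B) :=
    fderiv_comp B hf hF
  refine (congrArg (fun L => L W) h1).trans ?_
  rw [ContinuousLinearMap.comp_apply]
  congr 1
  ext i j
  rw [Matrix.of_apply, (hF.entry i j).lineDeriv_eq_fderiv]
  have h2 : HasFDerivAt F (fderiv ℝ F B) B := hF.hasFDerivAt
  have h3 := (hasFDerivAt_pi'.1 (hasFDerivAt_pi'.1 h2 i)) j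
  exact (congrArg (fun L => L W) h3.fderiv).symm

theorem hasDerivAt_line {f : Mat n → ℝ} {B : Mat n} (hf : DifferentiableAt ℝ f B) (W : Mat n) :
    HasDerivAt (fun t : ℝ => f (B + t • W)) (lineDeriv ℝ f B W) 0 :=
  hf.lineDifferentiableAt.hasLineDerivAt

theorem lineDeriv_entry (B W : Mat n) (i j : Fin n) :
    lineDeriv ℝ (fun X : Mat n => X i j) B W = W i j := by
  have h : HasDerivAt (fun t : ℝ => B i j + t * W i j) (W i j) 0 := by
    simpa using ((hasDerivAt_id (0 : ℝ)).mul_const (W i j)).const_add (B i j)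
  exact HasLineDerivAt.lineDeriv h

theorem lineDeriv_const_fun (a : ℝ) (B W : Mat n) :
    lineDeriv ℝ (fun _ : Mat n => a) B W = 0 := by
  simp [lineDeriv]

/-- The Leibniz rule for matrix products. -/
theorem lineDeriv_matrix_mul {F G : Mat n → Mat n} {B : Mat n}
    (hF : DifferentiableAt ℝ F B) (hG : DifferentiableAt ℝ G B) (W : Mat n) (i j : Fin n) :
    lineDeriv ℝ (fun X => (F X * G X) i j) B W
      = ((Matrix.of fun i j => lineDeriv ℝ (fun X => F X i j) B W) * G B
        + F B * Matrix.of fun i j => lineDeriv ℝ (fun X => G X i j) B W) i j := by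
  have h : HasDerivAt (fun t : ℝ => (F (B + t • W) * G (B + t • W)) i j)
      (∑ a, (lineDeriv ℝ (fun X => F X i a) B W * G (B + (0 : ℝ) • W) a j
        + F (B + (0 : ℝ) • W) i a * lineDeriv ℝ (fun X => G X a j) B W)) 0 := by
    simp only [Matrix.mul_apply]
    exact HasDerivAt.fun_sum fun a _ =>
      (hasDerivAt_line (hF.entry i a) W).mul (hasDerivAt_line (hG.entry a j) W)
  refine (HasLineDerivAt.lineDeriv (f := fun X => (F X * G X) i j) h).trans ?_
  simp [Matrix.add_apply, Matrix.mul_apply, Finset.sum_add_distrib]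

/-- Jacobi's formula at an invertible matrix. -/
theorem lineDeriv_det {B : Mat n} (hB : IsUnit B.det) (W : Mat n) :
    lineDeriv ℝ Matrix.det B W = B.det * (B⁻¹ * W).trace := by
  set p : Polynomial ℝ :=
    (1 + (Polynomial.X : Polynomial ℝ) • (B⁻¹ * W).map Polynomial.C).det with hp
  have hfun : (fun t : ℝ => (B + t • W).det) = fun t => B.det * p.eval t := by
    funext t
    have h1 : B + t • W = B * (1 + t • (B⁻¹ * W)) := by
      rw [Matrix.mul_add, Matrix.mul_one, Matrix.mul_smul, ← Matrix.mul_assoc,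
        Matrix.mul_nonsing_inv _ hB, Matrix.one_mul]
    rw [h1, Matrix.det_mul, hp, ← Polynomial.coe_evalRingHom, RingHom.map_det]
    congr 2
    ext i j
    by_cases hij : i = j <;> simp [hij, mul_comm t, -Matrix.map_mul]
  have h2 : HasDerivAt (fun t : ℝ => (B + t • W).det) (B.det * (B⁻¹ * W).trace) 0 := by
    rw [hfun, ← Matrix.derivative_det_one_add_X_smul]
    exact (p.hasDerivAt 0).const_mul _
  exact HasLineDerivAt.lineDeriv h2

end Calculus

/-! ### Brackets as derivatives along Hamiltonian vector fields -/

/-- The Hamiltonian vector field of `g` at `X`: the matrix with entries `{x_{ij}, g}`. -/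
noncomputable def hamiltonianField (tensor : Mat n → Mat₂ n) (g : Mat n → ℝ) (X : Mat n) : Mat n :=
  Matrix.of fun i j => ∑ k, ∑ l, tensor X (i, k) (j, l) * entryDeriv g X k l

/-- The matrix of all `M_{(i,k),(j,l)}` for fixed `i`, `j`. For a bracket tensor this is the
direction along which `{x_{ij}, ·}` differentiates. -/
def slice (M : Mat₂ n) (i j : Fin n) : Mat n :=
  Matrix.of fun k l => M (i, k) (j, l)

theorem bracketOf_eq_sum (tensor : Mat n → Mat₂ n) (f g : Mat n → ℝ) (X : Mat n) :
    bracketOf tensor f g X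
      = ∑ i, ∑ j, hamiltonianField tensor g X i j * entryDeriv f X i j := by
  simp only [bracketOf, hamiltonianField, Matrix.of_apply, Finset.sum_mul]
  refine Finset.sum_congr rfl fun i _ => Finset.sum_congr rfl fun j _ =>
    Finset.sum_congr rfl fun k _ => Finset.sum_congr rfl fun l _ => ?_
  ring

theorem bracketOf_eq_lineDeriv (tensor : Mat n → Mat₂ n) {f : Mat n → ℝ} (g : Mat n → ℝ)
    {X : Mat n} (hf : DifferentiableAt ℝ f X) :
    bracketOf tensor f g X = lineDeriv ℝ f X (hamiltonianField tensor g X) := by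
  rw [lineDeriv_eq_sum_entryDeriv hf, bracketOf_eq_sum]

theorem hamiltonianField_apply (tensor : Mat n → Mat₂ n) {g : Mat n → ℝ} {X : Mat n}
    (hg : DifferentiableAt ℝ g X) (i j : Fin n) :
    hamiltonianField tensor g X i j = lineDeriv ℝ g X (slice (tensor X) i j) := by
  rw [lineDeriv_eq_sum_entryDeriv hg]
  rfl

theorem bracketOf_entry_left (tensor : Mat n → Mat₂ n) {g : Mat n → ℝ} {X : Mat n}
    (hg : DifferentiableAt ℝ g X) (i j : Fin n) :
    bracketOf tensor (fun Y => Y i j) g X = lineDeriv ℝ g X (slice (tensor X) i j) := by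
  rw [bracketOf_eq_lineDeriv tensor g (differentiableAt_entry X i j), lineDeriv_entry,
    hamiltonianField_apply tensor hg]

theorem bracketOf_swap (tensor : Mat n → Mat₂ n) (f g : Mat n → ℝ) (X : Mat n) :
    bracketOf tensor f g X
      = bracketOf (fun Y => (tensor Y).submatrix Prod.swap Prod.swap) g f X := by
  simp only [bracketOf, Matrix.submatrix_apply, Prod.swap_prod_mk]
  calc _ = ∑ p : Fin n × Fin n, ∑ q : Fin n × Fin n,
        tensor X (p.1, q.1) (p.2, q.2) * entryDeriv f X p.1 p.2 * entryDeriv g X q.1 q.2 := by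
        simp only [Fintype.sum_prod_type]
    _ = ∑ q : Fin n × Fin n, ∑ p : Fin n × Fin n,
        tensor X (p.1, q.1) (p.2, q.2) * entryDeriv g X q.1 q.2 * entryDeriv f X p.1 p.2 := by
        rw [Finset.sum_comm]
        exact Finset.sum_congr rfl fun _ _ => Finset.sum_congr rfl fun _ _ => by ring
    _ = _ := by simp only [Fintype.sum_prod_type]

/-- The chain rule in the first argument of a bracket. -/
theorem bracketOf_comp_left (tensor : Mat n → Mat₂ n) {f : Mat n → ℝ} {F : Mat n → Mat n}
    (g : Mat n → ℝ) {B : Mat n} (hf : DifferentiableAt ℝ f (F B)) (hF : DifferentiableAt ℝ F B) :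
    bracketOf tensor (fun X => f (F X)) g B
      = ∑ i, ∑ j, bracketOf tensor (fun X => F X i j) g B * entryDeriv f (F B) i j := by
  rw [bracketOf_eq_lineDeriv tensor g (differentiableAt_comp hf hF), lineDeriv_comp hf hF,
    lineDeriv_eq_sum_entryDeriv hf]
  refine Finset.sum_congr rfl fun i _ => Finset.sum_congr rfl fun j _ => ?_
  rw [Matrix.of_apply, bracketOf_eq_lineDeriv tensor g (hF.entry i j)]

/-- The chain rule: the bracket of functions of `F` and of `G` is determined by the brackets of
the entries of `F` with those of `G`. -/
theorem bracketOf_comp (tensor : Mat n → Mat₂ n) {f g : Mat n → ℝ} {F G : Mat n → Mat n}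
    {B : Mat n} (hf : DifferentiableAt ℝ f (F B)) (hF : DifferentiableAt ℝ F B)
    (hg : DifferentiableAt ℝ g (G B)) (hG : DifferentiableAt ℝ G B) :
    bracketOf tensor (fun X => f (F X)) (fun X => g (G X)) B
      = ∑ i, ∑ j, ∑ k, ∑ l, tensorBracket (bracketOf tensor) F G B (i, k) (j, l)
          * entryDeriv f (F B) i j * entryDeriv g (G B) k l := by
  rw [bracketOf_comp_left tensor _ hf hF]
  refine Finset.sum_congr rfl fun i _ => Finset.sum_congr rfl fun j _ => ?_
  rw [bracketOf_swap, bracketOf_comp_left _ _ hg hG, Finset.sum_mul]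
  refine Finset.sum_congr rfl fun k _ => ?_
  rw [Finset.sum_mul]
  refine Finset.sum_congr rfl fun l _ => ?_
  rw [bracketOf_swap]
  simp only [Matrix.submatrix_submatrix, Prod.swap_swap_eq, Matrix.submatrix_id_id, tensorBracket,
    Matrix.of_apply]
  ring

/-! ### Multiplicativity of the trigonometric bracket -/

theorem differentiableAt_const_mul (T X : Mat n) :
    DifferentiableAt ℝ (fun Y : Mat n => T * Y) X :=
  differentiableAt_matrix_mul (differentiableAt_const T) differentiableAt_id

theorem differentiableAt_mul_const (T X : Mat n) :
    DifferentiableAt ℝ (fun Y : Mat n => Y * T) X :=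
  differentiableAt_matrix_mul differentiableAt_id (differentiableAt_const T)

theorem lineDeriv_const_mul (T X W : Mat n) (i j : Fin n) :
    lineDeriv ℝ (fun Y : Mat n => (T * Y) i j) X W = (T * W) i j := by
  rw [lineDeriv_matrix_mul (differentiableAt_const T) differentiableAt_fun_id]
  have h : (Matrix.of fun i j => lineDeriv ℝ (fun Y : Mat n => Y i j) X W) = W := by
    ext i j; simp [lineDeriv_entry]
  have h' : (Matrix.of fun i j => lineDeriv ℝ (fun _ : Mat n => T i j) X W) = 0 := by
    ext i j; simp [lineDeriv_const_fun]
  simp [h, h']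

theorem lineDeriv_mul_const (T X W : Mat n) (i j : Fin n) :
    lineDeriv ℝ (fun Y : Mat n => (Y * T) i j) X W = (W * T) i j := by
  rw [lineDeriv_matrix_mul differentiableAt_fun_id (differentiableAt_const T)]
  have h : (Matrix.of fun i j => lineDeriv ℝ (fun Y : Mat n => Y i j) X W) = W := by
    ext i j; simp [lineDeriv_entry]
  have h' : (Matrix.of fun i j => lineDeriv ℝ (fun _ : Mat n => T i j) X W) = 0 := by
    ext i j; simp [lineDeriv_const_fun]
  simp [h, h']

theorem tensorBracket_const_mul (T X : Mat n) (i k j l : Fin n) :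
    tensorBracket trigBracket (fun Y => T * Y) (fun Y => T * Y) X (i, k) (j, l)
      = ∑ p, ∑ q, T i p * T k q * trigTensor X (p, q) (j, l) := by
  simp only [tensorBracket, Matrix.of_apply, trigBracket]
  rw [bracketOf_eq_lineDeriv _ _ ((differentiableAt_const_mul T X).entry i j),
    lineDeriv_const_mul, Matrix.mul_apply]
  refine Finset.sum_congr rfl fun p _ => ?_
  rw [hamiltonianField_apply _ ((differentiableAt_const_mul T X).entry k l), lineDeriv_const_mul,
    Matrix.mul_apply, Finset.mul_sum]
  refine Finset.sum_congr rfl fun q _ => ?_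
  simp only [slice, Matrix.of_apply]
  ring

theorem tensorBracket_mul_const (T X : Mat n) (i k j l : Fin n) :
    tensorBracket trigBracket (fun Y => Y * T) (fun Y => Y * T) X (i, k) (j, l)
      = ∑ p, ∑ q, trigTensor X (i, k) (p, q) * T p j * T q l := by
  simp only [tensorBracket, Matrix.of_apply, trigBracket]
  rw [bracketOf_eq_lineDeriv _ _ ((differentiableAt_mul_const T X).entry i j),
    lineDeriv_mul_const, Matrix.mul_apply]
  refine Finset.sum_congr rfl fun p _ => ?_
  rw [hamiltonianField_apply _ ((differentiableAt_mul_const T X).entry k l), lineDeriv_mul_const,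
    Matrix.mul_apply, Finset.sum_mul]
  refine Finset.sum_congr rfl fun q _ => ?_
  simp only [slice, Matrix.of_apply]
  ring

/-- The trigonometric tensor is multiplicative: the terms with `r` between the two factors of
`T₂ T₁` cancel. -/
theorem trigTensor_mul (T₁ T₂ : Mat n) (i k j l : Fin n) :
    (∑ p, ∑ q, T₂ i p * T₂ k q * trigTensor T₁ (p, q) (j, l))
      + ∑ p, ∑ q, trigTensor T₂ (i, k) (p, q) * T₁ p j * T₁ q l
      = trigTensor (T₂ * T₁) (i, k) (j, l) := by
  simp only [trigTensor_apply]
  rw [Finset.sum_comm (f := fun p q => T₂ i q * T₂ k p * (theta q p - theta i k) * T₁ p j * T₁ q l),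
    ← Finset.sum_add_distrib, Matrix.mul_apply, Matrix.mul_apply, Finset.sum_mul_sum,
    Finset.sum_mul]
  refine Finset.sum_congr rfl fun p _ => ?_
  rw [← Finset.sum_add_distrib, Finset.sum_mul]
  exact Finset.sum_congr rfl fun q _ => by ring

theorem pairBracket_mul (T₁ T₂ : Mat n) {f g : Mat n → ℝ}
    (hf : DifferentiableAt ℝ f (T₂ * T₁)) (hg : DifferentiableAt ℝ g (T₂ * T₁)) :
    pairBracket (fun T => f (T.2 * T.1)) (fun T => g (T.2 * T.1)) (T₁, T₂)
      = trigBracket f g (T₂ * T₁) := by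
  have h1 := bracketOf_comp (trigTensor (n := n)) (F := fun Y => T₂ * Y) (G := fun Y => T₂ * Y)
    (B := T₁) hf (differentiableAt_const_mul T₂ T₁) hg (differentiableAt_const_mul T₂ T₁)
  have h2 := bracketOf_comp (trigTensor (n := n)) (F := fun Y => Y * T₁) (G := fun Y => Y * T₁)
    (B := T₂) hf (differentiableAt_mul_const T₁ T₂) hg (differentiableAt_mul_const T₁ T₂)
  simp only [pairBracket, trigBracket]
  rw [h1, h2, bracketOf]
  simp only [← Finset.sum_add_distrib]
  refine Finset.sum_congr rfl fun i _ => Finset.sum_congr rfl fun j _ =>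
    Finset.sum_congr rfl fun k _ => Finset.sum_congr rfl fun l _ => ?_
  have h3 := tensorBracket_const_mul T₂ T₁ i k j l
  have h4 := tensorBracket_mul_const T₁ T₂ i k j l
  simp only [trigBracket] at h3 h4
  rw [h3, h4, ← trigTensor_mul]
  ring

/-! ### Corner minors -/

theorem sum_eq_sum_castLE {k : ℕ} (hk : k ≤ n) {f : Fin n → ℝ}
    (hf : ∀ j : Fin n, k ≤ (j : ℕ) → f j = 0) : ∑ j, f j = ∑ a : Fin k, f (Fin.castLE hk a) := by
  symm
  refine Fintype.sum_of_injective (Fin.castLE hk) (Fin.castLE_injective hk) _ _ (fun j hj => ?_)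
    fun _ => rfl
  refine hf j (not_lt.1 fun h => hj ⟨⟨j, h⟩, rfl⟩)

theorem sum_eq_sum_last {k : ℕ} (hk : k ≤ n) {f : Fin n → ℝ}
    (hf : ∀ j : Fin n, (j : ℕ) < n - k → f j = 0) :
    ∑ j, f j = ∑ a : Fin k, f ⟨n - k + a, by omega⟩ := by
  symm
  refine Fintype.sum_of_injective (fun a : Fin k => (⟨n - k + a, by omega⟩ : Fin n)) ?_ _ _
    (fun j hj => ?_) fun _ => rfl
  · intro a b hab
    simp only [Fin.mk.injEq] at hab
    exact Fin.ext (by omega)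
  · refine hf j (not_le.1 fun h => hj ⟨⟨j - (n - k), by omega⟩, Fin.ext ?_⟩)
    simp only
    omega

/-- A nonzero lower-left minor allows solving for the first `k` entries of `u B`, with `u`
supported on the last `k` rows. -/
theorem exists_vecMul_of_lowerLeftMinor_ne_zero {B : Mat n} {k : ℕ} {hk : k ≤ n}
    (h : lowerLeftMinor B k hk ≠ 0) (w : Fin n → ℝ) :
    ∃ u : Fin n → ℝ, (∀ i : Fin n, (i : ℕ) < n - k → u i = 0) ∧
      ∀ j : Fin n, (j : ℕ) < k → (u ᵥ* B) j = w j := by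
  set M := B.submatrix (fun i : Fin k => (⟨n - k + i, by omega⟩ : Fin n)) (Fin.castLE hk) with hM
  have hdet : IsUnit M.det := isUnit_iff_ne_zero.2 h
  set u' := (fun a => w (Fin.castLE hk a)) ᵥ* M⁻¹ with hu'
  have hu'M : u' ᵥ* M = fun a => w (Fin.castLE hk a) := by
    rw [hu', Matrix.vecMul_vecMul, Matrix.nonsing_inv_mul _ hdet, Matrix.vecMul_one]
  refine ⟨fun i => if hi : n - k ≤ (i : ℕ) then u' ⟨i - (n - k), by omega⟩ else 0,
    fun i hi => dif_neg (not_le.2 hi), fun j hj => ?_⟩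
  have h1 := congrFun hu'M ⟨j, hj⟩
  simp only [Matrix.vecMul, dotProduct] at h1 ⊢
  rw [sum_eq_sum_last hk]
  · refine Eq.trans (Finset.sum_congr rfl fun a _ => ?_) h1
    simp [hM]
  · intro i hi
    simp [not_le.2 hi]

/-- A nonzero lower-left minor allows solving for the last `k` entries of `B v`, with `v`
supported on the first `k` columns. -/
theorem exists_mulVec_of_lowerLeftMinor_ne_zero {B : Mat n} {k : ℕ} {hk : k ≤ n}
    (h : lowerLeftMinor B k hk ≠ 0) (w : Fin n → ℝ) :
    ∃ v : Fin n → ℝ, (∀ j : Fin n, k ≤ (j : ℕ) → v j = 0) ∧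
      ∀ i : Fin n, n - k ≤ (i : ℕ) → (B *ᵥ v) i = w i := by
  set M := B.submatrix (fun i : Fin k => (⟨n - k + i, by omega⟩ : Fin n)) (Fin.castLE hk) with hM
  have hdet : IsUnit M.det := isUnit_iff_ne_zero.2 h
  set w' : Fin k → ℝ := fun a => w ⟨n - k + a, by omega⟩ with hw'
  set v' := M⁻¹ *ᵥ w' with hv'
  have hMv' : M *ᵥ v' = w' := by
    rw [hv', Matrix.mulVec_mulVec, Matrix.mul_nonsing_inv _ hdet, Matrix.one_mulVec]
  refine ⟨fun j => if hj : (j : ℕ) < k then v' ⟨j, hj⟩ else 0,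
    fun j hj => dif_neg (not_lt.2 hj), fun i hi => ?_⟩
  have h1 := congrFun hMv' ⟨i - (n - k), by omega⟩
  have h2 : (⟨n - k + (i - (n - k)), by omega⟩ : Fin n) = i := Fin.ext (by simp only; omega)
  simp only [Matrix.mulVec, dotProduct, hw', h2] at h1 ⊢
  rw [sum_eq_sum_castLE hk]
  · refine Eq.trans (Finset.sum_congr rfl fun a _ => ?_) h1
    simp [hM, h2]
  · intro j hj
    simp [not_lt.2 hj]

theorem lowerLeftMinor_ne_zero {B : Mat n} {k : ℕ} (hk : k ≤ n)
    (h : ∀ v : Fin n → ℝ, (∀ j : Fin n, k ≤ (j : ℕ) → v j = 0) →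
      (∀ i : Fin n, n - k ≤ (i : ℕ) → (B *ᵥ v) i = 0) → v = 0) :
    lowerLeftMinor B k hk ≠ 0 := by
  intro h0
  obtain ⟨v', hv', hMv'⟩ := Matrix.exists_mulVec_eq_zero_iff.2 h0
  refine hv' (funext fun a => ?_)
  have h1 := h (fun j => if hj : (j : ℕ) < k then v' ⟨j, hj⟩ else 0)
    (fun j hj => dif_neg (not_lt.2 hj)) fun i hi => ?_
  · simpa using congrFun h1 (Fin.castLE hk a)
  · have h1 := congrFun hMv' ⟨i - (n - k), by omega⟩
    have h2 : (⟨n - k + (i - (n - k)), by omega⟩ : Fin n) = i := Fin.ext (by simp only; omega)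
    simp only [Matrix.mulVec, dotProduct, Pi.zero_apply] at h1 ⊢
    rw [sum_eq_sum_castLE hk]
    · refine Eq.trans (Finset.sum_congr rfl fun a _ => ?_) h1
      simp [h2]
    · intro j hj
      simp [not_lt.2 hj]

theorem upperRightMinor_eq (B : Mat n) (k : ℕ) (hk : k ≤ n) :
    upperRightMinor B k hk = lowerLeftMinor Bᵀ k hk := by
  rw [upperRightMinor, lowerLeftMinor, ← Matrix.det_transpose]
  rfl

theorem InGeneralPosition.det_ne_zero {B : Mat n} (hB : InGeneralPosition B) : B.det ≠ 0 := by
  have h := (hB n le_rfl).1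
  have h2 : lowerLeftMinor B n le_rfl = B.det := by
    unfold lowerLeftMinor
    congr 1
    ext i j
    simp
  rwa [h2] at h

/-! ### Uniqueness and differentiability of the compatible form -/

/-- The equations for `A` have only the trivial solution with zero diagonal. Row `k` of `A`, with
the rows below it already known to vanish, is read off by pairing `B A Bᵀ` with a vector
supported on its last `k + 1` rows and one supported on its first `n - (k + 1)` columns, a block
below the diagonal. -/
theorem InGeneralPosition.eq_zero {B A : Mat n} (hB : InGeneralPosition B)
    (hA : ∀ i j, j ≤ i → A i j = 0) (hBA : IsUpper (B * A * Bᵀ)) : A = 0 := by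
  suffices h : ∀ k j, A k j = 0 by ext k j; exact h k j
  intro k
  induction k using WellFoundedGT.induction with
  | ind k ih =>
    intro j
    rcases le_or_gt j k with hjk | hkj
    · exact hA k j hjk
    -- `u B` agrees with the `k`-th unit vector up to index `k`, and `v Bᵀ` with the `j`-th one
    -- beyond it, so the pairing of `u` and `v` is `A k j` once the rows below `k` vanish.
    obtain ⟨u, hu, huB⟩ := exists_vecMul_of_lowerLeftMinor_ne_zero
      (hB (k + 1) k.isLt).1 (Pi.single k 1)
    have h2 := (hB (n - (k + 1)) (by omega)).2
    rw [upperRightMinor_eq] at h2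
    obtain ⟨v, hv, hvB⟩ := exists_mulVec_of_lowerLeftMinor_ne_zero h2 (Pi.single j 1)
    have h3 : u ⬝ᵥ ((B * A * Bᵀ) *ᵥ v) = 0 := by
      simp only [dotProduct, Matrix.mulVec, Finset.mul_sum]
      refine Finset.sum_eq_zero fun a _ => Finset.sum_eq_zero fun b _ => ?_
      rcases lt_or_ge (a : ℕ) (n - (k + 1)) with ha | ha
      · rw [hu a ha, zero_mul]
      rcases lt_or_ge (b : ℕ) (n - (k + 1)) with hb | hb
      · rw [hBA a b (Fin.lt_def.2 (by omega))]; ring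
      · rw [hv b hb]; ring
    rw [← Matrix.mulVec_mulVec, ← Matrix.mulVec_mulVec, Matrix.dotProduct_mulVec] at h3
    rw [← h3, dotProduct, Finset.sum_eq_single k, huB k (by omega), Pi.single_eq_same, one_mul,
      Matrix.mulVec, dotProduct, Finset.sum_eq_single j, hvB j (by omega), Pi.single_eq_same,
      mul_one]
    · intro b _ hb
      rcases le_or_gt b k with hbk | hkb
      · rw [hA k b hbk, zero_mul]
      · rw [hvB b (by omega), Pi.single_eq_of_ne hb, mul_zero]
    · simp
    · intro a _ ha
      rcases lt_or_gt_of_ne ha with hak | hka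
      · rw [huB a (by omega), Pi.single_eq_of_ne ha, zero_mul]
      · have : (A *ᵥ (Bᵀ *ᵥ v)) a = 0 := by
          simp [Matrix.mulVec, dotProduct, ih a hka]
        rw [this, mul_zero]
    · simp

/-- The matrix of the linear system `IsCompatible` in the entries of `A`: a row `(i, j)` with
`i < j` asks for entry `(j, i)` of `X A Xᵀ`, and the other rows ask for `A i j` itself. -/
def compatibleSystem (X : Mat n) : Mat₂ n :=
  Matrix.of fun p q => if p.1 < p.2 then X p.2 q.1 * X p.1 q.2 else if p = q then 1 else 0

theorem compatibleSystem_mulVec (X A : Mat n) (i j : Fin n) :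
    (compatibleSystem X *ᵥ fun p => A p.1 p.2) (i, j)
      = if i < j then (X * A * Xᵀ) j i else A i j := by
  simp only [Matrix.mulVec, dotProduct, compatibleSystem, Matrix.of_apply]
  split_ifs with h
  · simp only [Fintype.sum_prod_type, Matrix.mul_apply, Matrix.transpose_apply, Finset.sum_mul]
    rw [Finset.sum_comm]
    exact Finset.sum_congr rfl fun _ _ => Finset.sum_congr rfl fun _ _ => by ring
  · simp

theorem isCompatible_iff_mulVec (c : Fin n → ℝ) (X A : Mat n) :
    IsCompatible c X A ↔
      (compatibleSystem X *ᵥ fun p => A p.1 p.2) = fun p => Matrix.diagonal c p.1 p.2 := by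
  rw [funext_iff, Prod.forall]
  simp only [compatibleSystem_mulVec]
  constructor
  · rintro ⟨h1, h2, h3⟩ i j
    split_ifs with h
    · rw [h3 j i h, Matrix.diagonal_apply_ne _ h.ne]
    · rcases eq_or_lt_of_le (not_lt.1 h) with rfl | h'
      · rw [h2, Matrix.diagonal_apply_eq]
      · rw [h1 i j h', Matrix.diagonal_apply_ne _ h'.ne']
  · intro h
    refine ⟨fun i j hij => ?_, fun i => ?_, fun i j hij => ?_⟩
    · simpa [hij.not_gt, hij.ne'] using h i j
    · simpa using h i i
    · simpa [hij, hij.ne] using h j i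

theorem InGeneralPosition.det_compatibleSystem_ne_zero {B : Mat n} (hB : InGeneralPosition B) :
    (compatibleSystem B).det ≠ 0 := by
  intro h0
  obtain ⟨v, hv, hKv⟩ := Matrix.exists_mulVec_eq_zero_iff.2 h0
  have h1 : IsCompatible 0 B (Matrix.of fun i j => v (i, j)) := by
    rw [isCompatible_iff_mulVec]
    refine Eq.trans hKv (funext fun p => ?_)
    simp [Matrix.diagonal_apply]
  have h2 : (Matrix.of fun i j => v (i, j)) = (0 : Mat n) := by
    refine hB.eq_zero (fun i j hij => ?_) h1.2.2
    rcases eq_or_lt_of_le hij with rfl | h'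
    · exact h1.2.1 _
    · exact h1.1 i j h'
  exact hv (funext fun p => congrFun (congrFun h2 p.1) p.2)

/-- Cramer's rule for the compatible form. -/
theorem isCompatible_iff_cramer (c : Fin n → ℝ) {X : Mat n} (hX : (compatibleSystem X).det ≠ 0)
    (A : Mat n) :
    IsCompatible c X A ↔ A = Matrix.of fun i j => (compatibleSystem X).det⁻¹ *
      (compatibleSystem X).cramer (fun p => Matrix.diagonal c p.1 p.2) (i, j) := by
  rw [isCompatible_iff_mulVec]
  have hsol := Matrix.mulVec_cramer (compatibleSystem X) fun p => Matrix.diagonal c p.1 p.2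
  have hinj := Matrix.mulVec_injective_of_isUnit
    ((Matrix.isUnit_iff_isUnit_det _).2 (isUnit_iff_ne_zero.2 hX))
  set K := compatibleSystem X
  have h1 : K *ᵥ (K.det⁻¹ • K.cramer fun p => Matrix.diagonal c p.1 p.2)
      = fun p => Matrix.diagonal c p.1 p.2 := by
    rw [Matrix.mulVec_smul, hsol, smul_smul, inv_mul_cancel₀ hX, one_smul]
  constructor
  · intro h
    have h2 := hinj (h.trans h1.symm)
    ext i j
    exact congrFun h2 (i, j)
  · rintro rfl
    exact h1

theorem isCompatible_iff_eq_sourceForm (c : Fin n → ℝ) {X : Mat n}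
    (hX : (compatibleSystem X).det ≠ 0) (A : Mat n) :
    IsCompatible c X A ↔ A = sourceForm c X := by
  have hex : ∃ A, IsCompatible c X A := ⟨_, (isCompatible_iff_cramer c hX _).2 rfl⟩
  have hs : IsCompatible c X (sourceForm c X) := by
    rw [sourceForm, dif_pos hex]
    exact hex.choose_spec
  refine ⟨fun h => ?_, fun h => h ▸ hs⟩
  rw [(isCompatible_iff_cramer c hX A).1 h, ← (isCompatible_iff_cramer c hX _).1 hs]

section Calculus

attribute [local instance] Matrix.normedAddCommGroup Matrix.normedSpace

theorem differentiableAt_compatibleSystem (B : Mat n) (p q : Fin n × Fin n) :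
    DifferentiableAt ℝ (fun X => compatibleSystem X p q) B := by
  simp only [compatibleSystem, Matrix.of_apply]
  split_ifs
  · exact (differentiableAt_entry B _ _).mul (differentiableAt_entry B _ _)
  · exact differentiableAt_const _
  · exact differentiableAt_const _

theorem InGeneralPosition.eventually_det_ne_zero {B : Mat n} (hB : InGeneralPosition B) :
    ∀ᶠ X in nhds B, (compatibleSystem X).det ≠ 0 :=
  (differentiableAt_det (differentiableAt_compatibleSystem B)).continuousAt.eventually_ne
    hB.det_compatibleSystem_ne_zero

theorem InGeneralPosition.eventually_isCompatible {B : Mat n} (hB : InGeneralPosition B)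
    (c : Fin n → ℝ) : ∀ᶠ X in nhds B, IsCompatible c X (sourceForm c X) :=
  hB.eventually_det_ne_zero.mono fun _ hX => (isCompatible_iff_eq_sourceForm c hX _).2 rfl

theorem InGeneralPosition.differentiableAt_sourceForm {B : Mat n} (hB : InGeneralPosition B)
    (c : Fin n → ℝ) : DifferentiableAt ℝ (sourceForm c) B := by
  refine differentiableAt_of_entries fun i j => ?_
  have h1 : DifferentiableAt ℝ (fun X => (compatibleSystem X).det⁻¹ *
      (compatibleSystem X).cramer (fun p => Matrix.diagonal c p.1 p.2) (i, j)) B := by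
    refine ((differentiableAt_det (differentiableAt_compatibleSystem B)).inv
      hB.det_compatibleSystem_ne_zero).mul ?_
    simp only [Matrix.cramer_apply]
    refine differentiableAt_det fun p q => ?_
    simp only [Matrix.updateCol_apply]
    split_ifs
    · exact differentiableAt_const _
    · exact differentiableAt_compatibleSystem B p q
  refine h1.congr_of_eventuallyEq (hB.eventually_det_ne_zero.mono fun X hX => ?_)
  have h2 := (isCompatible_iff_cramer c hX _).1 ((isCompatible_iff_eq_sourceForm c hX _).2 rfl)
  exact congrFun (congrFun h2 i) j

theorem differentiableAt_transpose (B : Mat n) :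
    DifferentiableAt ℝ (fun X : Mat n => Xᵀ) B :=
  differentiableAt_of_entries fun i j => differentiableAt_entry B j i

theorem InGeneralPosition.differentiableAt_targetForm {B : Mat n} (hB : InGeneralPosition B)
    (c : Fin n → ℝ) : DifferentiableAt ℝ (targetForm c) B :=
  differentiableAt_matrix_mul
    (differentiableAt_matrix_mul differentiableAt_fun_id (hB.differentiableAt_sourceForm c))
    (differentiableAt_transpose B)

theorem InGeneralPosition.lineDeriv_targetForm {B : Mat n} (hB : InGeneralPosition B)
    (c : Fin n → ℝ) (W : Mat n) (i j : Fin n) :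
    lineDeriv ℝ (fun X => targetForm c X i j) B W
      = (W * sourceForm c B * Bᵀ
        + B * (Matrix.of fun i j => lineDeriv ℝ (fun X => sourceForm c X i j) B W) * Bᵀ
        + B * sourceForm c B * Wᵀ) i j := by
  have hA := hB.differentiableAt_sourceForm c
  have hX : (Matrix.of fun i j => lineDeriv ℝ (fun X : Mat n => X i j) B W) = W := by
    ext i j; simp [lineDeriv_entry]
  have hXt : (Matrix.of fun i j => lineDeriv ℝ (fun X : Mat n => Xᵀ i j) B W) = Wᵀ := by
    ext i j; simp [lineDeriv_entry]
  have hXA : (Matrix.of fun i j => lineDeriv ℝ (fun X : Mat n => (X * sourceForm c X) i j) B W)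
      = W * sourceForm c B
        + B * Matrix.of fun i j => lineDeriv ℝ (fun X => sourceForm c X i j) B W := by
    ext i j
    rw [Matrix.of_apply, lineDeriv_matrix_mul differentiableAt_fun_id hA, hX]
  simp only [targetForm]
  rw [lineDeriv_matrix_mul (differentiableAt_matrix_mul differentiableAt_fun_id hA)
    (differentiableAt_transpose B), hXA, hXt, Matrix.add_mul]

theorem lineDeriv_eq_zero_of_eventually_const {f : Mat n → ℝ} {B : Mat n} {a : ℝ}
    (h : ∀ᶠ X in nhds B, f X = a) (W : Mat n) : lineDeriv ℝ f B W = 0 := by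
  have h1 : f =ᶠ[nhds B] fun _ => a := h
  rw [h1.lineDeriv_eq, lineDeriv_const_fun]

/-- The variation of the compatible form in the direction `W` is the only strictly
upper-triangular matrix that keeps `B A Bᵀ` upper-triangular to first order. -/
theorem InGeneralPosition.lineDeriv_sourceForm {B : Mat n} (hB : InGeneralPosition B)
    (c : Fin n → ℝ) {W H : Mat n} (hH : ∀ i j, j ≤ i → H i j = 0)
    (hU : IsUpper (W * sourceForm c B * Bᵀ + B * H * Bᵀ + B * sourceForm c B * Wᵀ)) :
    (Matrix.of fun i j => lineDeriv ℝ (fun X => sourceForm c X i j) B W) = H := by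
  have hev := hB.eventually_isCompatible c
  set D : Mat n := Matrix.of fun i j => lineDeriv ℝ (fun X => sourceForm c X i j) B W with hD
  have hD1 : ∀ i j, j ≤ i → D i j = 0 := by
    intro i j hij
    rcases eq_or_lt_of_le hij with rfl | h
    · exact lineDeriv_eq_zero_of_eventually_const (hev.mono fun X hX => hX.2.1 _) W
    · exact lineDeriv_eq_zero_of_eventually_const (hev.mono fun X hX => hX.1 _ _ h) W
  have hD2 : IsUpper (W * sourceForm c B * Bᵀ + B * D * Bᵀ + B * sourceForm c B * Wᵀ) := by
    intro i j hij
    rw [hD, ← hB.lineDeriv_targetForm c W i j]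
    exact lineDeriv_eq_zero_of_eventually_const (hev.mono fun X hX => hX.2.2 i j hij) W
  refine sub_eq_zero.1 (hB.eq_zero (fun i j hij => ?_) fun i j hij => ?_)
  · rw [Matrix.sub_apply, hD1 i j hij, hH i j hij, sub_zero]
  · have h1 : B * (D - H) * Bᵀ
        = (W * sourceForm c B * Bᵀ + B * D * Bᵀ + B * sourceForm c B * Wᵀ)
          - (W * sourceForm c B * Bᵀ + B * H * Bᵀ + B * sourceForm c B * Wᵀ) := by
      noncomm_ring
    rw [h1, Matrix.sub_apply, hD2 i j hij, hU i j hij, sub_zero]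

end Calculus

/-! ### Brackets with the compatible form -/

theorem mul_single_one_mul_apply (X Y : Mat n) (i j k l : Fin n) :
    (X * (Matrix.single j i 1 : Mat n) * Y) k l = X k j * Y i l := by
  simp [Matrix.mul_apply, Matrix.single_apply, ite_and]

theorem single_one_mul_apply (Y : Mat n) (i j k l : Fin n) :
    ((Matrix.single j i 1 : Mat n) * Y) k l = if k = j then Y i l else 0 := by
  simp [Matrix.mul_apply, Matrix.single_apply, ite_and, eq_comm]

theorem mul_single_one_apply (X : Mat n) (i j k l : Fin n) :
    (X * (Matrix.single j i 1 : Mat n)) k l = if l = i then X k j else 0 := by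
  simp [Matrix.mul_apply, Matrix.single_apply, ite_and, eq_comm]

theorem diagonal_theta_add (j : Fin n) :
    (Matrix.diagonal fun a => theta j a) + (Matrix.diagonal fun a => theta a j) = (1 : Mat n) := by
  rw [Matrix.diagonal_add]
  simp [theta_add_theta_swap]

/-- The direction `{b_{ij}, ·}` of the trigonometric bracket. -/
theorem slice_trigTensor (B : Mat n) (i j : Fin n) :
    slice (trigTensor B) i j
      = B * Matrix.single j i 1 * B * (Matrix.diagonal fun a => theta a j)
        - (Matrix.diagonal fun a => theta i a) * (B * Matrix.single j i 1 * B) := by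
  ext k l
  simp only [slice, Matrix.of_apply, trigTensor_apply, Matrix.sub_apply, Matrix.mul_diagonal,
    Matrix.diagonal_mul, mul_single_one_mul_apply]
  ring

/-- The variation `{b_{ij}, A}` of the compatible form `A`. -/
noncomputable def entryVariation (B A : Mat n) (i j : Fin n) : Mat n :=
  Matrix.single j i 1 * (B * (Matrix.diagonal fun a => theta j a) * A)
    - A * (Matrix.diagonal fun a => theta a j) * Bᵀ * Matrix.single i j 1

theorem entryVariation_apply (B A : Mat n) (i j k l : Fin n) :
    entryVariation B A i j k l
      = (if k = j then ∑ a, theta j a * B i a * A a l else 0)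
        - if l = j then ∑ a, theta a j * B i a * A k a else 0 := by
  simp only [entryVariation, Matrix.sub_apply, single_one_mul_apply, mul_single_one_apply]
  simp only [Matrix.mul_apply (M := B * _), Matrix.mul_apply (M := A * _), Matrix.mul_diagonal,
    Matrix.transpose_apply]
  congr 2 <;> exact Finset.sum_congr rfl fun _ _ => by ring

theorem entryVariation_apply_eq_zero (B : Mat n) {A : Mat n} (hA : IsUpper A) (i j : Fin n)
    {k l : Fin n} (hlk : l ≤ k) : entryVariation B A i j k l = 0 := by
  rw [entryVariation_apply]
  -- Only the index `a = j` can contribute to either sum, and only when `k = l = j`.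
  have h1 : (if k = j then ∑ a, theta j a * B i a * A a l else 0)
      = if k = j ∧ l = j then 1 / 2 * B i j * A j j else 0 := by
    by_cases hk : k = j
    · subst hk
      rw [if_pos rfl, Finset.sum_eq_single k]
      · by_cases hl : l = k
        · subst hl; simp [theta_self]
        · simp [hl, hA k l (lt_of_le_of_ne hlk hl)]
      · intro a _ hak
        rcases lt_or_gt_of_ne hak with h | h
        · rw [theta_of_gt h]; ring
        · rw [hA a l (lt_of_le_of_lt hlk h)]; ring
      · simp
    · simp [hk]
  have h2 : (if l = j then ∑ a, theta a j * B i a * A k a else 0)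
      = if k = j ∧ l = j then 1 / 2 * B i j * A j j else 0 := by
    by_cases hl : l = j
    · subst hl
      rw [if_pos rfl, Finset.sum_eq_single l]
      · by_cases hk : k = l
        · subst hk; simp [theta_self]
        · simp [hk, hA k l (lt_of_le_of_ne hlk (Ne.symm hk))]
      · intro a _ hal
        rcases lt_or_gt_of_ne hal with h | h
        · rw [hA k a (lt_of_lt_of_le h hlk)]; ring
        · rw [theta_of_gt h]; ring
      · simp
    · simp [hl]
  rw [h1, h2, sub_self]

/-- The variation of `B A Bᵀ` along `{b_{ij}, ·}`: the terms with a `theta` between `B` and `A`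
combine by `θ(x) + θ(-x) = 1`. -/
theorem entryVariation_target (B A : Mat n) (i j : Fin n) :
    slice (trigTensor B) i j * A * Bᵀ + B * entryVariation B A i j * Bᵀ
        + B * A * (slice (trigTensor B) i j)ᵀ
      = (Matrix.diagonal fun a => theta a i) * (B * Matrix.single j i 1 * (B * A * Bᵀ))
        - B * A * Bᵀ * Matrix.single i j 1 * Bᵀ * Matrix.diagonal fun a => theta i a := by
  have hj := eq_sub_of_add_eq (diagonal_theta_add j)
  have hi := eq_sub_of_add_eq' (diagonal_theta_add i)
  rw [slice_trigTensor, entryVariation, hj, hi]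
  simp only [Matrix.transpose_sub, Matrix.transpose_mul, Matrix.transpose_single,
    Matrix.diagonal_transpose]
  noncomm_ring

theorem entryVariation_target_apply (B A : Mat n) (i j k l : Fin n) :
    (slice (trigTensor B) i j * A * Bᵀ + B * entryVariation B A i j * Bᵀ
        + B * A * (slice (trigTensor B) i j)ᵀ) k l
      = theta k i * B k j * (B * A * Bᵀ) i l - theta i l * (B * A * Bᵀ) k i * B l j := by
  rw [entryVariation_target, Matrix.sub_apply, Matrix.diagonal_mul, Matrix.mul_diagonal,
    mul_single_one_mul_apply, mul_single_one_mul_apply, Matrix.transpose_apply]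
  ring

/-- The matrix generating the Hamiltonian fields of the entries `(k, l)` of `A` and of
`Ã = B A Bᵀ`: these are `B N` with `N` formed from `A`, and `N B` with `N` formed from `Ã`. -/
noncomputable def formGenerator (A : Mat n) (k l : Fin n) : Mat n :=
  (Matrix.diagonal fun a => theta k a) * A * Matrix.single l k 1
    - (Matrix.diagonal fun a => theta a l) * Aᵀ * Matrix.single k l 1

theorem formGenerator_apply (A : Mat n) (k l p q : Fin n) :
    formGenerator A k l p q
      = (if q = k then theta k p * A p l else 0) - if q = l then theta p l * A k p else 0 := by
  simp only [formGenerator, Matrix.sub_apply, mul_single_one_apply, Matrix.diagonal_mul,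
    Matrix.transpose_apply]

theorem formGenerator_mul_apply (A X : Mat n) (k l p q : Fin n) :
    (formGenerator A k l * X) p q = theta k p * A p l * X k q - theta p l * A k p * X l q := by
  simp [Matrix.mul_apply, formGenerator_apply, sub_mul]

/-- The generator acts on the form itself, as on bilinear forms, by minus the reflection
bracket. -/
theorem formGenerator_act (A : Mat n) (i j k l : Fin n) :
    (formGenerator A k l * A + A * (formGenerator A k l)ᵀ) i j
      = -reflectionTensor A (i, k) (j, l) := by
  have h : A * (formGenerator A k l)ᵀ = (formGenerator A k l * Aᵀ)ᵀ := by
    rw [Matrix.transpose_mul, Matrix.transpose_transpose]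
  rw [h, Matrix.add_apply, Matrix.transpose_apply, formGenerator_mul_apply,
    formGenerator_mul_apply, reflectionTensor_apply, theta_swap k i, theta_swap j l]
  simp only [Matrix.transpose_apply]
  ring

theorem InGeneralPosition.isCompatible {B : Mat n} (hB : InGeneralPosition B) (c : Fin n → ℝ) :
    IsCompatible c B (sourceForm c B) :=
  (isCompatible_iff_eq_sourceForm c hB.det_compatibleSystem_ne_zero _).2 rfl

theorem InGeneralPosition.isUpper_targetForm {B : Mat n} (hB : InGeneralPosition B)
    (c : Fin n → ℝ) : IsUpper (targetForm c B) :=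
  (hB.isCompatible c).2.2

section Relations

variable {B : Mat n} (hB : InGeneralPosition B) (c : Fin n → ℝ)
include hB

theorem InGeneralPosition.lineDeriv_sourceForm_slice (i j : Fin n) :
    (Matrix.of fun k l => lineDeriv ℝ (fun X => sourceForm c X k l) B (slice (trigTensor B) i j))
      = entryVariation B (sourceForm c B) i j := by
  refine hB.lineDeriv_sourceForm c
    (fun k l hlk => entryVariation_apply_eq_zero B (hB.isCompatible c).1 i j hlk) fun k l hlk => ?_
  have hT := hB.isUpper_targetForm c
  rw [entryVariation_target_apply]
  change theta k i * B k j * targetForm c B i l - theta i l * targetForm c B k i * B l j = 0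
  have h1 : theta k i * targetForm c B i l = 0 := by
    rcases lt_or_ge i k with h | h
    · rw [theta_of_gt h, zero_mul]
    · rw [hT i l (lt_of_lt_of_le hlk h), mul_zero]
  have h2 : theta i l * targetForm c B k i = 0 := by
    rcases lt_or_ge l i with h | h
    · rw [theta_of_gt h, zero_mul]
    · rw [hT k i (lt_of_le_of_lt h hlk), mul_zero]
  linear_combination B k j * h1 - B l j * h2

theorem InGeneralPosition.lineDeriv_targetForm_slice (i j k l : Fin n) :
    lineDeriv ℝ (fun X => targetForm c X k l) B (slice (trigTensor B) i j)
      = theta k i * B k j * targetForm c B i l - theta i l * targetForm c B k i * B l j := by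
  rw [hB.lineDeriv_targetForm c, hB.lineDeriv_sourceForm_slice c, entryVariation_target_apply]
  rfl

theorem InGeneralPosition.tensorBracket_entry_sourceForm :
    tensorBracket trigBracket (fun X : Mat n => X) (sourceForm c) B
      = leg₁ B * (rMatrix n)ᵀ * leg₂ (sourceForm c B)
        - leg₁ B * leg₂ (sourceForm c B) * partialTranspose₂ (rMatrix n) := by
  ext ⟨i, k⟩ ⟨j, l⟩
  rw [Matrix.sub_apply, leg₁_mul_rMatrix_transpose_mul_leg₂_apply,
    leg₁_mul_leg₂_mul_partialTranspose₂_apply, ← entryVariation_apply,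
    ← hB.lineDeriv_sourceForm_slice c]
  exact bracketOf_entry_left _ ((hB.differentiableAt_sourceForm c).entry k l) i j

theorem InGeneralPosition.tensorBracket_entry_targetForm :
    tensorBracket trigBracket (fun X : Mat n => X) (targetForm c) B
      = (rMatrix n)ᵀ * leg₁ B * leg₂ (targetForm c B)
        - leg₂ (targetForm c B) * partialTranspose₂ (rMatrix n) * leg₁ B := by
  ext ⟨i, k⟩ ⟨j, l⟩
  rw [Matrix.sub_apply, Matrix.mul_assoc (rMatrix n)ᵀ, rMatrix_transpose_mul_apply,
    leg₁_mul_leg₂_apply, leg₂_mul_partialTranspose₂_mul_leg₁_apply, ← mul_assoc,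
    ← hB.lineDeriv_targetForm_slice c]
  exact bracketOf_entry_left _ ((hB.differentiableAt_targetForm c).entry k l) i j

theorem InGeneralPosition.hamiltonianField_sourceForm (k l : Fin n) :
    hamiltonianField trigTensor (fun X => sourceForm c X k l) B
      = B * formGenerator (sourceForm c B) k l := by
  ext p q
  rw [hamiltonianField_apply _ ((hB.differentiableAt_sourceForm c).entry k l)]
  refine (congrFun (congrFun (hB.lineDeriv_sourceForm_slice c p q) k) l).trans ?_
  rw [entryVariation_apply, Matrix.mul_apply]
  simp only [formGenerator_apply, mul_sub, Finset.sum_sub_distrib]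
  congr 1
  · by_cases h : q = k
    · subst h
      simp only [if_true]
      exact Finset.sum_congr rfl fun _ _ => by ring
    · simp [h, Ne.symm h]
  · by_cases h : q = l
    · subst h
      simp only [if_true]
      exact Finset.sum_congr rfl fun _ _ => by ring
    · simp [h, Ne.symm h]

theorem InGeneralPosition.hamiltonianField_targetForm (k l : Fin n) :
    hamiltonianField trigTensor (fun X => targetForm c X k l) B
      = formGenerator (targetForm c B) k l * B := by
  ext p q
  rw [hamiltonianField_apply _ ((hB.differentiableAt_targetForm c).entry k l),
    hB.lineDeriv_targetForm_slice c, formGenerator_mul_apply]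
  ring

/-- Along the Hamiltonian field `B N` of an entry of `A`, the form `B A Bᵀ` stays constant when
`A` varies by `-(N A + A Nᵀ)`, and this is strictly upper-triangular. -/
theorem InGeneralPosition.lineDeriv_sourceForm_hamiltonianField_sourceForm (k l : Fin n) :
    (Matrix.of fun i j => lineDeriv ℝ (fun X => sourceForm c X i j) B
        (hamiltonianField trigTensor (fun X => sourceForm c X k l) B))
      = -(formGenerator (sourceForm c B) k l * sourceForm c B
          + sourceForm c B * (formGenerator (sourceForm c B) k l)ᵀ) := by
  rw [hB.hamiltonianField_sourceForm c]
  refine hB.lineDeriv_sourceForm c (fun i j hji => ?_) ?_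
  · rw [Matrix.neg_apply, formGenerator_act, neg_neg,
      reflectionTensor_apply_eq_zero (hB.isCompatible c).1 hji]
  · have h : ∀ N A : Mat n,
        B * N * A * Bᵀ + B * -(N * A + A * Nᵀ) * Bᵀ + B * A * (B * N)ᵀ = 0 := by
      intro N A
      rw [Matrix.transpose_mul]
      noncomm_ring
    rw [h]
    exact fun _ _ _ => rfl

/-- Along the Hamiltonian field `N B` of an entry of `Ã = B A Bᵀ`, the form `A` is constant:
`Ã` then varies by `N Ã + Ã Nᵀ`, which is upper-triangular. -/
theorem InGeneralPosition.lineDeriv_sourceForm_hamiltonianField_targetForm (k l : Fin n) :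
    (Matrix.of fun i j => lineDeriv ℝ (fun X => sourceForm c X i j) B
        (hamiltonianField trigTensor (fun X => targetForm c X k l) B)) = 0 := by
  rw [hB.hamiltonianField_targetForm c]
  refine hB.lineDeriv_sourceForm c (fun i j _ => rfl) fun i j hji => ?_
  have h : formGenerator (targetForm c B) k l * B * sourceForm c B * Bᵀ + B * 0 * Bᵀ
        + B * sourceForm c B * (formGenerator (targetForm c B) k l * B)ᵀ
      = formGenerator (targetForm c B) k l * targetForm c B
        + targetForm c B * (formGenerator (targetForm c B) k l)ᵀ := by
    rw [Matrix.transpose_mul]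
    simp only [targetForm]
    noncomm_ring
  rw [h, formGenerator_act, reflectionTensor_apply_eq_zero (hB.isUpper_targetForm c) hji.le,
    neg_zero]

theorem InGeneralPosition.tensorBracket_sourceForm_sourceForm :
    tensorBracket trigBracket (sourceForm c) (sourceForm c) B
      = reflectionTensor (sourceForm c B) := by
  ext ⟨i, k⟩ ⟨j, l⟩
  rw [← neg_neg (reflectionTensor _ _ _), ← formGenerator_act, ← Matrix.neg_apply,
    ← hB.lineDeriv_sourceForm_hamiltonianField_sourceForm c]
  exact bracketOf_eq_lineDeriv _ _ ((hB.differentiableAt_sourceForm c).entry i j)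

theorem InGeneralPosition.tensorBracket_sourceForm_targetForm :
    tensorBracket trigBracket (sourceForm c) (targetForm c) B = 0 := by
  ext ⟨i, k⟩ ⟨j, l⟩
  refine (bracketOf_eq_lineDeriv _ _ ((hB.differentiableAt_sourceForm c).entry i j)).trans ?_
  exact congrFun (congrFun (hB.lineDeriv_sourceForm_hamiltonianField_targetForm c k l) i) j

theorem InGeneralPosition.tensorBracket_targetForm_targetForm :
    tensorBracket trigBracket (targetForm c) (targetForm c) B
      = -reflectionTensor (targetForm c B) := by
  ext ⟨i, k⟩ ⟨j, l⟩
  refine (bracketOf_eq_lineDeriv _ _ ((hB.differentiableAt_targetForm c).entry i j)).trans ?_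
  rw [hB.lineDeriv_targetForm c, hB.lineDeriv_sourceForm_hamiltonianField_targetForm c,
    hB.hamiltonianField_targetForm c, Matrix.neg_apply, ← formGenerator_act]
  refine congrFun (congrFun ?_ i) j
  rw [Matrix.transpose_mul]
  simp only [targetForm]
  noncomm_ring

/-! ### Casimirs -/

/-- By Jacobi's formula and cyclicity of the trace, `{b_{ij}, det B}` is `det B * b_{ij}` times
`θ(0) - θ(0)`. -/
theorem InGeneralPosition.trigBracket_det {f : Mat n → ℝ} (hf : DifferentiableAt ℝ f B) :
    trigBracket f Matrix.det B = 0 := by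
  have hdet : IsUnit B.det := isUnit_iff_ne_zero.2 hB.det_ne_zero
  have hd : DifferentiableAt ℝ (Matrix.det : Mat n → ℝ) B :=
    differentiableAt_det (M := fun X => X) (differentiableAt_entry B)
  have h : hamiltonianField trigTensor Matrix.det B = 0 := by
    ext i j
    rw [hamiltonianField_apply _ hd, lineDeriv_det hdet, slice_trigTensor, Matrix.mul_sub,
      Matrix.trace_sub]
    have h1 : B⁻¹ * (B * Matrix.single j i 1 * B * Matrix.diagonal fun a => theta a j)
        = Matrix.single j i 1 * (B * Matrix.diagonal fun a => theta a j) := by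
      simp only [Matrix.mul_assoc]
      rw [Matrix.nonsing_inv_mul_cancel_left _ _ hdet]
    have h2 : (B⁻¹ * ((Matrix.diagonal fun a => theta i a) * (B * Matrix.single j i 1 * B))).trace
        = (Matrix.single j i 1 * Matrix.diagonal (fun a => theta i a) * B).trace := by
      rw [Matrix.trace_mul_comm, Matrix.mul_assoc, Matrix.mul_assoc, Matrix.mul_nonsing_inv _ hdet,
        Matrix.mul_one, ← Matrix.mul_assoc, Matrix.trace_mul_comm, ← Matrix.mul_assoc]
    rw [h1, h2, Matrix.mul_assoc]
    simp [Matrix.trace, single_one_mul_apply, theta_self, mul_comm (B i j)]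
  rw [trigBracket, bracketOf_eq_lineDeriv _ _ hf, h, lineDeriv_eq_sum_entryDeriv hf]
  simp

/-- In `{b_{ij}, Ã_{kk}}` the factor `theta` and the triangularity of `Ã` leave only `i = k`, where
the two terms cancel. -/
theorem InGeneralPosition.trigBracket_targetForm_diag {f : Mat n → ℝ}
    (hf : DifferentiableAt ℝ f B) (k : Fin n) :
    trigBracket f (fun X => targetForm c X k k) B = 0 := by
  have hT := hB.isUpper_targetForm c
  have h : hamiltonianField trigTensor (fun X => targetForm c X k k) B = 0 := by
    ext i j
    rw [hamiltonianField_apply _ ((hB.differentiableAt_targetForm c).entry k k),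
      hB.lineDeriv_targetForm_slice c, Matrix.zero_apply]
    rcases lt_trichotomy i k with h | rfl | h
    · rw [theta_of_gt h, hT k i h]; ring
    · ring
    · rw [theta_of_gt h, hT i k h]; ring
  rw [trigBracket, bracketOf_eq_lineDeriv _ _ hf, h, lineDeriv_eq_sum_entryDeriv hf]
  simp

end Relations

theorem tensorBracket_entry_entry (B : Mat n) :
    tensorBracket trigBracket (fun X : Mat n => X) (fun X => X) B = trigTensor B := by
  ext ⟨i, k⟩ ⟨j, l⟩
  exact (bracketOf_entry_left _ (differentiableAt_entry B k l) i j).trans (lineDeriv_entry B _ k l)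

/-! ### Triangular matrices and transport matrices -/

theorem isUpper_iff_blockTriangular {A : Mat n} : IsUpper A ↔ A.BlockTriangular id :=
  ⟨fun h _ _ hij => h _ _ hij, fun h _ _ hij => h hij⟩

theorem IsUpper.mul {A B : Mat n} (hA : IsUpper A) (hB : IsUpper B) : IsUpper (A * B) :=
  isUpper_iff_blockTriangular.2
    ((isUpper_iff_blockTriangular.1 hA).mul (isUpper_iff_blockTriangular.1 hB))

theorem IsUpper.inv {A : Mat n} (hA : IsUpper A) : IsUpper A⁻¹ := by
  by_cases h : IsUnit A.det
  · have := A.invertibleOfIsUnitDet h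
    exact isUpper_iff_blockTriangular.2
      (Matrix.blockTriangular_inv_of_blockTriangular (isUpper_iff_blockTriangular.1 hA))
  · rw [Matrix.nonsing_inv_apply_not_isUnit _ h]
    exact fun _ _ _ => rfl

theorem IsUpper.transpose {A : Mat n} (hA : IsUpper A) : IsLower Aᵀ := fun i j hij => hA j i hij

theorem IsLower.transpose {A : Mat n} (hA : IsLower A) : IsUpper Aᵀ := fun i j hij => hA j i hij

theorem IsLower.mul {A B : Mat n} (hA : IsLower A) (hB : IsLower B) : IsLower (A * B) := by
  have h := (hB.transpose.mul hA.transpose).transpose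
  rwa [← Matrix.transpose_mul, Matrix.transpose_transpose] at h

theorem IsLower.inv {A : Mat n} (hA : IsLower A) : IsLower A⁻¹ := by
  have h := hA.transpose.inv.transpose
  rwa [← Matrix.transpose_nonsing_inv, Matrix.transpose_transpose] at h

theorem antidiagS_mul_apply (X : Mat n) (i j : Fin n) :
    (antidiagS n * X) i j = (-1) ^ ((i : ℕ) + 1) * X (Fin.rev i) j := by
  simp [Matrix.mul_apply, antidiagS]

theorem mul_antidiagS_apply (X : Mat n) (i j : Fin n) :
    (X * antidiagS n) i j = X i (Fin.rev j) * (-1) ^ ((Fin.rev j : ℕ) + 1) := by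
  rw [Matrix.mul_apply, Finset.sum_eq_single (Fin.rev j)]
  · simp [antidiagS]
  · intro b _ hb
    have : j ≠ Fin.rev b := fun h => hb (by rw [h, Fin.rev_rev])
    simp [antidiagS, this]
  · simp

theorem neg_one_pow_rev (i : Fin n) :
    (-1 : ℝ) ^ ((Fin.rev i : ℕ) + 1) = (-1) ^ (n + 1) * (-1) ^ ((i : ℕ) + 1) := by
  have h : n + 1 = (Fin.rev i : ℕ) + 1 + ((i : ℕ) + 1) := by
    rw [Fin.val_rev]; omega
  rw [h, pow_add _ _ ((i : ℕ) + 1), mul_assoc, ← mul_pow]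
  simp

theorem antidiagS_mul_self : antidiagS n * antidiagS n = (-1 : ℝ) ^ (n + 1) • 1 := by
  ext i j
  rw [antidiagS_mul_apply, antidiagS, Matrix.of_apply, Fin.rev_rev, Matrix.smul_apply,
    Matrix.one_apply]
  by_cases h : j = i
  · subst h
    rw [if_pos rfl, if_pos rfl, neg_one_pow_rev, mul_left_comm, ← mul_pow]
    simp
  · simp [h, Ne.symm h]

theorem antidiagS_transpose : (antidiagS n)ᵀ = (-1 : ℝ) ^ (n + 1) • antidiagS n := by
  ext i j
  rw [Matrix.transpose_apply, Matrix.smul_apply, antidiagS, Matrix.of_apply, Matrix.of_apply]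
  by_cases h : j = Fin.rev i
  · subst h
    rw [Fin.rev_rev, if_pos rfl, if_pos rfl, neg_one_pow_rev, smul_eq_mul]
  · have h' : i ≠ Fin.rev j := fun h' => h (by rw [h', Fin.rev_rev])
    simp [h, h']

theorem neg_one_pow_smul_smul (m : ℕ) (X : Mat n) : (-1 : ℝ) ^ m • (-1 : ℝ) ^ m • X = X := by
  rw [smul_smul, ← mul_pow]
  simp

theorem isUnit_det_antidiagS : IsUnit (antidiagS n).det := by
  refine (Matrix.isUnit_iff_isUnit_det _).1 ?_
  have h : antidiagS n * ((-1 : ℝ) ^ (n + 1) • antidiagS n) = 1 := by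
    rw [Matrix.mul_smul, antidiagS_mul_self, neg_one_pow_smul_smul]
  exact IsUnit.of_mul_eq_one _ h

theorem antidiagS_conj_apply (X : Mat n) (i j : Fin n) :
    (antidiagS n * X * antidiagS n) i j
      = (-1) ^ ((i : ℕ) + 1) * X (Fin.rev i) (Fin.rev j) * (-1) ^ ((Fin.rev j : ℕ) + 1) := by
  rw [mul_antidiagS_apply, antidiagS_mul_apply]

theorem IsUpper.antidiagS_conj {X : Mat n} (hX : IsUpper X) :
    IsLower (antidiagS n * X * antidiagS n) := by
  intro i j hij
  rw [antidiagS_conj_apply, hX _ _ (Fin.rev_lt_rev.2 hij)]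
  ring

theorem IsLower.antidiagS_conj {X : Mat n} (hX : IsLower X) :
    IsUpper (antidiagS n * X * antidiagS n) := by
  intro i j hij
  rw [antidiagS_conj_apply, hX _ _ (Fin.rev_lt_rev.2 hij)]
  ring

theorem IsUpper.mulVec_apply_eq_zero {U : Mat n} (hU : IsUpper U) {y : Fin n → ℝ} {m : ℕ}
    (hy : ∀ i : Fin n, m ≤ (i : ℕ) → y i = 0) (i : Fin n) (hi : m ≤ (i : ℕ)) :
    (U *ᵥ y) i = 0 := by
  rw [Matrix.mulVec, dotProduct]
  refine Finset.sum_eq_zero fun j _ => ?_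
  rcases lt_or_ge j i with h | h
  · rw [hU i j h, zero_mul]
  · rw [hy j (hi.trans (Fin.le_def.1 h)), mul_zero]

/-- The big cell: `U S V` with `U` and `V` upper-triangular and invertible has nonzero lower-left
minors. -/
theorem lowerLeftMinor_mul_antidiagS_mul_ne_zero {U V : Mat n} (hU : IsUpper U) (hV : IsUpper V)
    (hU' : IsUnit U.det) (hV' : IsUnit V.det) (k : ℕ) (hk : k ≤ n) :
    lowerLeftMinor (U * antidiagS n * V) k hk ≠ 0 := by
  refine lowerLeftMinor_ne_zero hk fun v hv hBv => ?_
  set x := antidiagS n *ᵥ (V *ᵥ v) with hx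
  have hx0 : ∀ i : Fin n, (i : ℕ) < n - k → x i = 0 := by
    intro i hi
    have h1 := hV.mulVec_apply_eq_zero hv (Fin.rev i) (by rw [Fin.val_rev]; omega)
    rw [hx, Matrix.mulVec, dotProduct]
    refine Finset.sum_eq_zero fun j _ => ?_
    by_cases hj : j = Fin.rev i
    · rw [hj, h1, mul_zero]
    · simp [antidiagS, hj]
  have hUx : ∀ i : Fin n, n - k ≤ (i : ℕ) → (U *ᵥ x) i = 0 := by
    intro i hi
    rw [hx, Matrix.mulVec_mulVec, Matrix.mulVec_mulVec]
    exact hBv i hi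
  have hxU : U⁻¹ *ᵥ (U *ᵥ x) = x := by
    rw [Matrix.mulVec_mulVec, Matrix.nonsing_inv_mul _ hU', Matrix.one_mulVec]
  have hx1 : x = 0 := by
    funext i
    rcases lt_or_ge (i : ℕ) (n - k) with hi | hi
    · exact hx0 i hi
    · rw [← hxU]
      exact hU.inv.mulVec_apply_eq_zero hUx i hi
  rw [hx, Matrix.mulVec_mulVec] at hx1
  refine Matrix.mulVec_injective_of_isUnit ((Matrix.isUnit_iff_isUnit_det _).2 ?_)
    (hx1.trans (Matrix.mulVec_zero _).symm)
  rw [Matrix.det_mul]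
  exact isUnit_det_antidiagS.mul hV'

theorem PathCondition.isUnit_det {T T' T'' : Mat n} (h : PathCondition T T' T'') :
    IsUnit T.det ∧ IsUnit T'.det ∧ IsUnit T''.det := by
  have h1 := congrArg Matrix.det h
  simp only [Matrix.det_mul, Matrix.det_one] at h1
  refine ⟨?_, ?_, ?_⟩ <;> refine isUnit_iff_ne_zero.2 fun h0 => ?_ <;> simp [h0] at h1

/-- The path condition expresses two sides of a triangle through the third. -/
theorem PathCondition.mul_mul {T T' T'' : Mat n} (h : PathCondition T T' T'') :
    T * antidiagS n * T' = antidiagS n * T''⁻¹ * antidiagS n := by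
  have hT := h.isUnit_det.2.2
  have hS := antidiagS_mul_self (n := n)
  set S := antidiagS n with hSdef
  have h1 : T * S * T' * (S * T'' * S) = 1 := by
    have h2 : T' * S * T'' * S * (T * S) = 1 := by
      rw [← Matrix.mul_assoc]; exact h
    rw [← mul_eq_one_comm.1 h2]
    simp only [Matrix.mul_assoc]
  have h3 : S * T'' * S * (S * T''⁻¹ * S) = 1 := by
    calc S * T'' * S * (S * T''⁻¹ * S) = S * T'' * (S * S) * T''⁻¹ * S := by
          simp only [Matrix.mul_assoc]
      _ = (-1 : ℝ) ^ (n + 1) • (S * (T'' * T''⁻¹) * S) := by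
          rw [hS]; simp only [Matrix.mul_smul, Matrix.smul_mul, Matrix.mul_one, Matrix.mul_assoc]
      _ = 1 := by
          rw [Matrix.mul_nonsing_inv _ hT, Matrix.mul_one, hS, neg_one_pow_smul_smul]
  exact left_inv_eq_right_inv h1 h3

/-- The path condition solved for one side, as a product `X S Y` in which `X` and `Y` are of the
opposite triangular type. -/
theorem PathCondition.eq_mul_mul {T T' T'' : Mat n} (h : PathCondition T T' T'') :
    T = antidiagS n * T''⁻¹ * antidiagS n * antidiagS n * (antidiagS n * T'⁻¹ * antidiagS n) := by
  have hS := antidiagS_mul_self (n := n)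
  rw [← h.mul_mul]
  set S := antidiagS n
  symm
  calc T * S * T' * S * (S * T'⁻¹ * S) = T * S * T' * (S * S) * T'⁻¹ * S := by
        simp only [Matrix.mul_assoc]
    _ = (-1 : ℝ) ^ (n + 1) • (T * S * (T' * T'⁻¹) * S) := by
        rw [hS]; simp only [Matrix.mul_smul, Matrix.smul_mul, Matrix.mul_one, Matrix.mul_assoc]
    _ = T := by
        rw [Matrix.mul_nonsing_inv _ h.isUnit_det.2.1, Matrix.mul_one, Matrix.mul_assoc, hS,
          Matrix.mul_smul, Matrix.mul_one, neg_one_pow_smul_smul]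

theorem isUnit_det_antidiagS_conj {X : Mat n} (hX : IsUnit X.det) :
    IsUnit (antidiagS n * X⁻¹ * antidiagS n).det := by
  rw [Matrix.det_mul, Matrix.det_mul]
  exact (isUnit_det_antidiagS.mul (Matrix.isUnit_nonsing_inv_det _ hX)).mul isUnit_det_antidiagS

section Transport

variable {T₁ T₁' T₁'' T₂ T₂' T₂'' : Mat n}

/-- The left triangle puts `B = T₂ T₁` into the form upper-`S`-upper, and the right triangle puts
it into the form lower-`S`-lower. -/
theorem inGeneralPosition_transport (h₁ : IsRightTriangle T₁ T₁' T₁'')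
    (h₂ : IsLeftTriangle T₂ T₂' T₂'') : InGeneralPosition (T₂ * T₁) := by
  obtain ⟨hT₁, hT₁', hT₁'', p₁⟩ := h₁
  obtain ⟨hT₂, hT₂', hT₂'', p₂⟩ := h₂
  have d₁ := p₁.isUnit_det
  have d₂ := p₂.isUnit_det
  intro k hk
  constructor
  · have h : T₂ * T₁ = antidiagS n * T₂''⁻¹ * antidiagS n * antidiagS n
        * (antidiagS n * T₂'⁻¹ * antidiagS n * T₁) := by
      conv_lhs => rw [p₂.eq_mul_mul]
      rw [← Matrix.mul_assoc _ _ T₁]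
    rw [h]
    refine lowerLeftMinor_mul_antidiagS_mul_ne_zero hT₂''.inv.antidiagS_conj
      (hT₂'.inv.antidiagS_conj.mul hT₁) (isUnit_det_antidiagS_conj d₂.2.2) ?_ k hk
    rw [Matrix.det_mul]
    exact (isUnit_det_antidiagS_conj d₂.2.1).mul d₁.1
  · have h : (T₂ * T₁)ᵀ = (-1 : ℝ) ^ (n + 1) • ((antidiagS n * T₁'⁻¹ * antidiagS n)ᵀ * antidiagS n
        * (T₂ * (antidiagS n * T₁''⁻¹ * antidiagS n))ᵀ) := by
      have hPQ : ∀ P Q : Mat n, (T₂ * (P * antidiagS n * Q))ᵀ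
          = (-1 : ℝ) ^ (n + 1) • (Qᵀ * antidiagS n * (T₂ * P)ᵀ) := by
        intro P Q
        simp only [Matrix.transpose_mul, antidiagS_transpose, Matrix.smul_mul, Matrix.mul_smul,
          Matrix.mul_assoc]
      conv_lhs => rw [p₁.eq_mul_mul]
      exact hPQ _ _
    have hm := lowerLeftMinor_mul_antidiagS_mul_ne_zero
      hT₁'.inv.antidiagS_conj.transpose
      (hT₂.mul hT₁''.inv.antidiagS_conj).transpose
      (by rw [Matrix.det_transpose]; exact isUnit_det_antidiagS_conj d₁.2.1)
      (by
        rw [Matrix.det_transpose, Matrix.det_mul]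
        exact d₂.1.mul (isUnit_det_antidiagS_conj d₁.2.2)) k hk
    rw [upperRightMinor_eq, h]
    unfold lowerLeftMinor at hm ⊢
    rw [Matrix.submatrix_smul, Pi.smul_apply, Pi.smul_apply, Matrix.det_smul]
    exact mul_ne_zero (pow_ne_zero _ (pow_ne_zero _ (by norm_num))) hm

theorem transport_form (h₁ : IsRightTriangle T₁ T₁' T₁'') (h₂ : IsLeftTriangle T₂ T₂' T₂'') :
    T₂ * T₁ * (T₁⁻¹ * antidiagS n * T₂' * T₁'ᵀ * antidiagS n) * (T₂ * T₁)ᵀ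
      = antidiagS n * T₂''⁻¹ * (T₁''ᵀ)⁻¹ * antidiagS n * T₂ᵀ := by
  have p₁ := h₁.2.2.2
  have p₂ := h₂.2.2.2
  have hS := antidiagS_mul_self (n := n)
  have e₂ := p₂.mul_mul
  have e₁ : T₁'ᵀ * antidiagS n * T₁ᵀ
      = (-1 : ℝ) ^ (n + 1) • (antidiagS n * (T₁''ᵀ)⁻¹ * antidiagS n) := by
    have h := congrArg Matrix.transpose p₁.mul_mul
    simp only [Matrix.transpose_mul, antidiagS_transpose, Matrix.transpose_nonsing_inv,
      Matrix.smul_mul, Matrix.mul_smul, neg_one_pow_smul_smul] at h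
    rw [Matrix.mul_assoc, ← neg_one_pow_smul_smul (n + 1) (T₁'ᵀ * _), h, Matrix.mul_assoc]
  set S := antidiagS n
  calc T₂ * T₁ * (T₁⁻¹ * S * T₂' * T₁'ᵀ * S) * (T₂ * T₁)ᵀ
      = T₂ * (T₁ * T₁⁻¹) * S * T₂' * (T₁'ᵀ * S * T₁ᵀ) * T₂ᵀ := by
        rw [Matrix.transpose_mul]; simp only [Matrix.mul_assoc]
    _ = (S * T₂''⁻¹ * S) * (T₁'ᵀ * S * T₁ᵀ) * T₂ᵀ := by
        rw [Matrix.mul_nonsing_inv _ p₁.isUnit_det.1, Matrix.mul_one, e₂]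
    _ = (-1 : ℝ) ^ (n + 1) • (S * T₂''⁻¹ * (S * S) * (T₁''ᵀ)⁻¹ * S * T₂ᵀ) := by
        rw [e₁]; simp only [Matrix.mul_smul, Matrix.smul_mul, Matrix.mul_assoc]
    _ = S * T₂''⁻¹ * (T₁''ᵀ)⁻¹ * S * T₂ᵀ := by
        rw [hS]
        simp only [Matrix.mul_smul, Matrix.smul_mul, Matrix.mul_one, neg_one_pow_smul_smul]

theorem isCompatible_transport (h₁ : IsRightTriangle T₁ T₁' T₁'')
    (h₂ : IsLeftTriangle T₂ T₂' T₂'') {A : Mat n}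
    (hA : A = T₁⁻¹ * antidiagS n * T₂' * T₁'ᵀ * antidiagS n) :
    IsCompatible (fun i => A i i) (T₂ * T₁) A := by
  refine ⟨?_, fun _ => rfl, ?_⟩
  · have h : A = T₁⁻¹ * (antidiagS n * (T₂' * T₁'ᵀ) * antidiagS n) := by
      rw [hA]; simp only [Matrix.mul_assoc]
    rw [h]
    exact h₁.1.inv.mul (h₂.2.1.mul h₁.2.1.transpose).antidiagS_conj
  · rw [hA, transport_form h₁ h₂]
    have h : antidiagS n * T₂''⁻¹ * (T₁''ᵀ)⁻¹ * antidiagS n * T₂ᵀ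
        = antidiagS n * (T₂''⁻¹ * (T₁''ᵀ)⁻¹) * antidiagS n * T₂ᵀ := by
      simp only [Matrix.mul_assoc]
    rw [h]
    exact (h₂.2.2.1.inv.mul h₁.2.2.1.transpose.inv).antidiagS_conj.mul h₂.1.transpose

end Transport

end PoissonLie

theorem mainTheorem3 (n : ℕ) :
    -- If `T₁` and `T₂` carry the trigonometric bracket and commute, then so does `B = T₂ T₁`.
    (∀ (T₁ T₂ : Mat n) (f g : Mat n → ℝ),
      DifferentiableAt ℝ f (T₂ * T₁) → DifferentiableAt ℝ g (T₂ * T₁) →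
      pairBracket (fun T => f (T.2 * T.1)) (fun T => g (T.2 * T.1)) (T₁, T₂)
        = trigBracket f g (T₂ * T₁)) ∧
    -- Transport matrices of the two triangles: `B`, `A` and `B A Bᵀ` in terms of them.
    (∀ T₁ T₁' T₁'' T₂ T₂' T₂'' : Mat n,
      IsRightTriangle T₁ T₁' T₁'' → IsLeftTriangle T₂ T₂' T₂'' →
      InGeneralPosition (T₂ * T₁) ∧
      ∀ A : Mat n, A = T₁⁻¹ * antidiagS n * T₂' * T₁'ᵀ * antidiagS n →
        A = sourceForm (fun i => A i i) (T₂ * T₁) ∧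
        targetForm (fun i => A i i) (T₂ * T₁)
          = antidiagS n * T₂''⁻¹ * (T₁''ᵀ)⁻¹ * antidiagS n * T₂ᵀ) ∧
    -- The reflection bracket restricts to upper-triangular matrices with a fixed diagonal.
    (∀ A : Mat n, IsUpper A → ∀ i j k l, j ≤ i → reflectionTensor A (i, k) (j, l) = 0) ∧
    -- The relations, for every fixed diagonal `c` of `A` (`c = 1` is the unipotent case).
    ∀ (c : Fin n → ℝ) (B : Mat n), InGeneralPosition B →
      -- `A` is a well-defined differentiable function of `B`
      (∀ A : Mat n, IsCompatible c B A ↔ A = sourceForm c B) ∧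
      DifferentiableAt ℝ (sourceForm c) B ∧
      (∀ A : Mat n, (B, A) ∈ groupoidPairs n ↔
        A = sourceForm (fun _ => 1) B ∧ ∀ k, targetForm (fun _ => 1) B k k = 1) ∧
      -- `det B` and the diagonal of `B A Bᵀ` are Casimirs
      (∀ f : Mat n → ℝ, DifferentiableAt ℝ f B →
        trigBracket f Matrix.det B = 0 ∧
        ∀ k, trigBracket f (fun X => targetForm c X k k) B = 0) ∧
      -- `B`-`B`
      tensorBracket trigBracket (fun X : Mat n => X) (fun X => X) B
        = -(rMatrix n * leg₁ B * leg₂ B) + leg₁ B * leg₂ B * rMatrix n ∧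
      -- `B`-`A`
      tensorBracket trigBracket (fun X : Mat n => X) (sourceForm c) B
        = leg₁ B * (rMatrix n)ᵀ * leg₂ (sourceForm c B)
          - leg₁ B * leg₂ (sourceForm c B) * partialTranspose₂ (rMatrix n) ∧
      -- `B`-`B A Bᵀ`
      tensorBracket trigBracket (fun X : Mat n => X) (targetForm c) B
        = (rMatrix n)ᵀ * leg₁ B * leg₂ (targetForm c B)
          - leg₂ (targetForm c B) * partialTranspose₂ (rMatrix n) * leg₁ B ∧
      -- `A`-`A`
      tensorBracket trigBracket (sourceForm c) (sourceForm c) B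
        = rMatrix n * leg₁ (sourceForm c B) * leg₂ (sourceForm c B)
          - leg₁ (sourceForm c B) * leg₂ (sourceForm c B) * rMatrix n
          - leg₁ (sourceForm c B) * partialTranspose₂ (rMatrix n) * leg₂ (sourceForm c B)
          + leg₂ (sourceForm c B) * partialTranspose₂ (rMatrix n) * leg₁ (sourceForm c B) ∧
      -- `B A Bᵀ`-`B A Bᵀ`
      tensorBracket trigBracket (targetForm c) (targetForm c) B
        = -(rMatrix n * leg₁ (targetForm c B) * leg₂ (targetForm c B))
          + leg₁ (targetForm c B) * leg₂ (targetForm c B) * rMatrix n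
          + leg₁ (targetForm c B) * partialTranspose₂ (rMatrix n) * leg₂ (targetForm c B)
          - leg₂ (targetForm c B) * partialTranspose₂ (rMatrix n) * leg₁ (targetForm c B) ∧
      -- `A`-`B A Bᵀ`
      tensorBracket trigBracket (sourceForm c) (targetForm c) B = 0 ∧
      -- `B ↦ A` is Poisson
      (∀ f g : Mat n → ℝ,
        DifferentiableAt ℝ f (sourceForm c B) → DifferentiableAt ℝ g (sourceForm c B) →
        trigBracket (fun X => f (sourceForm c X)) (fun X => g (sourceForm c X)) B
          = reflectionBracket f g (sourceForm c B)) ∧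
      -- `B ↦ B A Bᵀ` is anti-Poisson
      (∀ f g : Mat n → ℝ,
        DifferentiableAt ℝ f (targetForm c B) → DifferentiableAt ℝ g (targetForm c B) →
        trigBracket (fun X => f (targetForm c X)) (fun X => g (targetForm c X)) B
          = -reflectionBracket f g (targetForm c B)) ∧
      -- functions of `A` commute with functions of `B A Bᵀ`
      (∀ f g : Mat n → ℝ,
        DifferentiableAt ℝ f (sourceForm c B) → DifferentiableAt ℝ g (targetForm c B) →
        trigBracket (fun X => f (sourceForm c X)) (fun X => g (targetForm c X)) B = 0) := by
  refine ⟨fun T₁ T₂ f g hf hg => pairBracket_mul T₁ T₂ hf hg, ?_,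
    fun A hA i j k l hji => reflectionTensor_apply_eq_zero hA hji k l, ?_⟩
  · intro T₁ T₁' T₁'' T₂ T₂' T₂'' h₁ h₂
    have hB := inGeneralPosition_transport h₁ h₂
    refine ⟨hB, fun A hA => ?_⟩
    have hs : A = sourceForm (fun i => A i i) (T₂ * T₁) :=
      (isCompatible_iff_eq_sourceForm _ hB.det_compatibleSystem_ne_zero A).1
        (isCompatible_transport h₁ h₂ hA)
    refine ⟨hs, ?_⟩
    rw [targetForm, ← hs, hA, transport_form h₁ h₂]
  · intro c B hB
    have hA := hB.differentiableAt_sourceForm c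
    have hT := hB.differentiableAt_targetForm c
    have hAA := hB.tensorBracket_sourceForm_sourceForm c
    have hTT := hB.tensorBracket_targetForm_targetForm c
    have hAT := hB.tensorBracket_sourceForm_targetForm c
    refine ⟨isCompatible_iff_eq_sourceForm c hB.det_compatibleSystem_ne_zero, hA, fun A => ?_,
      fun f hf => ⟨hB.trigBracket_det hf, hB.trigBracket_targetForm_diag c hf⟩,
      tensorBracket_entry_entry B, hB.tensorBracket_entry_sourceForm c,
      hB.tensorBracket_entry_targetForm c, hAA, ?_, hAT, fun f g hf hg => ?_, fun f g hf hg => ?_,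
      fun f g hf hg => ?_⟩
    · rw [← isCompatible_iff_eq_sourceForm _ hB.det_compatibleSystem_ne_zero]
      constructor
      · rintro ⟨-, ⟨hU, hd⟩, hU', hd'⟩
        have hc : IsCompatible (fun _ => 1) B A := ⟨hU, hd, hU'⟩
        refine ⟨hc, fun k => ?_⟩
        rw [targetForm,
          ← (isCompatible_iff_eq_sourceForm _ hB.det_compatibleSystem_ne_zero A).1 hc]
        exact hd' k
      · rintro ⟨hc, hd⟩
        refine ⟨hB.det_ne_zero, ⟨hc.1, hc.2.1⟩, hc.2.2, fun k => ?_⟩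
        have h := hd k
        rwa [targetForm,
          ← (isCompatible_iff_eq_sourceForm _ hB.det_compatibleSystem_ne_zero A).1 hc] at h
    · rw [hTT, reflectionTensor]
      abel
    · rw [trigBracket] at hAA ⊢
      rw [bracketOf_comp _ hf hA hg hA, hAA]
      rfl
    · rw [trigBracket] at hTT ⊢
      rw [bracketOf_comp _ hf hT hg hT, hTT]
      simp only [reflectionBracket, bracketOf, Matrix.neg_apply, neg_mul, Finset.sum_neg_distrib]
    · rw [trigBracket] at hAT ⊢
      rw [bracketOf_comp _ hf hA hg hT, hAT]
      simp
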